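/- **Setting.** Let $\nu>0$. A polygonal pore domain $\overline\Omega\subset\mathbb R^2$ is the union of $N$ closed polygonal pore subdomains $\overline\Omega_1,\dots,\overline\Omega_N$ with pairwise disjoint interiors. Each $\Omega_i$ has its own conforming triangulation, with at least three triangles, any two of which can be joined by a chain of triangles sharing edges (meshes of different pores need not match). Each boundary edge of the mesh of $\Omega_i$ lies either on exactly one of $m$ internal interfaces, or on exactly one of $m^{\rm k}$ inlet/outlet pieces of $\partial\Omega$, or on the no-slip wall of $\Omega_i$. Every internal interface is, as a set, a common part of the boundaries of exactly two pores; inlet/outlet edges and wall edges lie on $\partial\Omega$. The wall of every pore contains at least one edge, and from every pore one can reach, passing through internal interfaces, a pore that has an inlet/outlet face. For each $i$ let $\Gamma_{i,1},\dots,\Gamma_{i,m_i}$ be the (nonempty) faces of $\Omega_i$, first the $m_i^{\rm u}$ internal ones, then the $m_i^{\rm k}$ inlet/outlet ones, with outward unit normals $\mathbf n_{i,r}$, and let $R_i^{\rm u}\in\{0,1\}^{m_i^{\rm u}\times m}$, $R_i^{\rm k}\in\{0,1\}^{m_i^{\rm k}\times m^{\rm k}}$ be the Boolean matrices which restrict global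 traction vectors to the faces of $\Omega_i$. Let $V_i^h$ be the space of continuous, piecewise quadratic vector fields on $\overline\Omega_i$ that vanish on the wall of $\Omega_i$, with a basis $\{\boldsymbol\phi_{i,j}\}_j$, and $Q_i^h$ the space of continuous, piecewise affine functions on $\overline\Omega_i$, with a basis $\{\psi_{i,l}\}_l$ (Taylor–Hood). Put $$(A_i)_{jk}=\nu\int_{\Omega_i}\nabla\boldsymbol\phi_{i,k}:\nabla\boldsymbol\phi_{i,j},\qquad (B_i)_{lj}=-\int_{\Omega_i}\psi_{i,l}\,\nabla\cdot\boldsymbol\phi_{i,j},\qquad (\mathbf f_i^{(r)})_j=-\int_{\Gamma_{i,r}}\boldsymbol\phi_{i,j}\cdot\mathbf n_{i,r},\qquad K_i=\begin{bmatrix}A_i&B_i^\top\\B_i&0\end{bmatrix}.$$ Let $\widetilde{\mathbf f}_i^{(r)}$ be the velocity block of the solution of $K_i\begin{bmatrix}\widetilde{\mathbf f}_i^{(r)}\\ \mathbf X_i^{(r)}\end{bmatrix}=\begin{bmatrix}\mathbf f_i^{(r)}\\ \mathbf 0\end{bmatrix}$, and let $G_i=\bigl[-(\mathbf f_i^{(k)})^\top\widetilde{\mathbf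 f}_i^{(r)}\bigr]_{k,r=1}^{m_i}$ be the local discrete Dirichlet-to-Neumann matrix, with blocks $G_i^{\rm uu},G_i^{\rm uk},G_i^{\rm ku},G_i^{\rm kk}$ with respect to internal and inlet/outlet faces. For prescribed inlet/outlet tractions $\mathbf p^{\rm k}\in\mathbb R^{m^{\rm k}}$ let $$S=-\sum_{i=1}^N (R_i^{\rm u})^\top G_i^{\rm uu}R_i^{\rm u},\qquad \mathbf F=\sum_{i=1}^N (R_i^{\rm u})^\top G_i^{\rm uk}R_i^{\rm k}\mathbf p^{\rm k}.$$ **Theorem 1 (Solvability and mass conservation of DD-PNM).** The local discrete Stokes problems are uniquely solvable: for every $i$ and all $t_1,\dots,t_{m_i}\in\mathbb R$ the system $K_i\begin{bmatrix}\mathbf U\\ \mathbf P\end{bmatrix}=\begin{bmatrix}\sum_r t_r\mathbf f_i^{(r)}\\ \mathbf 0\end{bmatrix}$ has exactly one solution; in particular, the matrices $G_i$ are well defined. Moreover: (i) $S$ is symmetric positive definite. (ii) The system $S\mathbf p=\mathbf F$ has a unique solution $\mathbf p\in\mathbb R^m$. (iii) For this $\mathbf p$, let $(p_{i,1},\dots,p_{i,m_i})=(R_i^{\rm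 u}\mathbf p,\,R_i^{\rm k}\mathbf p^{\rm k})$, let $\mathbf u_i^h\in V_i^h$ be the field with coefficient vector $\sum_{r} p_{i,r}\widetilde{\mathbf f}_i^{(r)}$, and let $\mathbf u^{\rm DD}$ be the field equal to $\mathbf u_i^h$ on $\Omega_i$. Then the face fluxes $Q_{i,r}=\int_{\Gamma_{i,r}}\mathbf u_i^h\cdot\mathbf n_{i,r}$ satisfy $$\sum_{r=1}^{m_i}Q_{i,r}=0\quad\text{for all }i,\qquad\text{and}\qquad\int_{\partial\Omega}\mathbf u^{\rm DD}\cdot\mathbf n=0 .$$ -/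

import Mathlib

open MeasureTheory
open scoped Matrix

noncomputable section

namespace DDPNM

/-- The Euclidean plane. -/
abbrev Plane : Type := EuclideanSpace ℝ (Fin 2)

/-! ### Triangulations -/

/-- A conforming triangulation of a polygonal region of the plane: finitely many nondegenerate
triangles (given by their vertex sets), two of which meet exactly in the convex hull of their
common vertices (nothing, a common vertex, or a common edge). -/
structure TriMesh where
  triangles : Finset (Finset Plane)
  card_eq : ∀ T ∈ triangles, T.card = 3
  indep : ∀ T ∈ triangles, AffineIndependent ℝ ((↑) : T → Plane)
  conforming : ∀ T ∈ triangles, ∀ T' ∈ triangles,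
    convexHull ℝ (T : Set Plane) ∩ convexHull ℝ (T' : Set Plane) ⊆
      convexHull ℝ ((T : Set Plane) ∩ (T' : Set Plane))

namespace TriMesh

variable (M : TriMesh)

/-- The closed polygonal region covered by the triangles. -/
def region : Set Plane := ⋃ T ∈ M.triangles, convexHull ℝ (T : Set Plane)

open scoped Classical in
/-- The edges of the mesh: two-point subsets of triangles. -/
def edges : Finset (Finset Plane) := M.triangles.biUnion fun T => T.powersetCard 2

open scoped Classical in
/-- The boundary edges: those which belong to exactly one triangle. Their segments make up the
boundary of the region. -/
def boundaryEdges : Finset (Finset Plane) :=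
  M.edges.filter fun e => ∃! T, T ∈ M.triangles ∧ e ⊆ T

/-- Any two triangles are joined by a chain of triangles of the mesh in which consecutive ones share
an edge; equivalently, the interior of the region is connected. -/
def EdgeConnected : Prop :=
  ∀ S ∈ M.triangles, ∀ T ∈ M.triangles,
    Relation.ReflTransGen
      (fun A B : Finset Plane => B ∈ M.triangles ∧ ∃ e ∈ M.edges, e ⊆ A ∧ e ⊆ B) S T

end TriMesh

/-- For an edge `e` of the triangle `T`: the vector from the centroid of `T` to the midpoint of `e`,
projected orthogonally to the direction of `e`, and normalized. This is the unit normal of `e`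
pointing out of `T`. -/
def outwardNormal (T e : Finset Plane) : Plane :=
  let w : Plane := (vectorSpan ℝ (e : Set Plane))ᗮ.starProjection
    ((1 / 2 : ℝ) • ∑ x ∈ e, x - (1 / 3 : ℝ) • ∑ x ∈ T, x)
  ‖w‖⁻¹ • w

open scoped Classical in
/-- The outward flux `∫_e v · n` through an edge with respect to arc length. For a boundary edge
there is exactly one triangle `T` that contains `e`, and the sum has one term. -/
def TriMesh.edgeFlux (M : TriMesh) (v : Plane → Plane) (e : Finset Plane) : ℝ :=
  ∑ T ∈ M.triangles with e ⊆ T,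
    ∫ x in convexHull ℝ (e : Set Plane), inner ℝ (v x) (outwardNormal T e) ∂(μH[1])

/-! ### Finite element spaces -/

/-- The space of continuous functions on the region of `M` that are polynomials of degree at most
`k` on each triangle. A function on the region is identified with its extension by zero. -/
def lagrangeSpace (M : TriMesh) (k : ℕ) : Submodule ℝ (Plane → ℝ) where
  carrier := {f | ContinuousOn f M.region ∧
    (∀ T ∈ M.triangles, ∃ P : MvPolynomial (Fin 2) ℝ, P.totalDegree ≤ k ∧
      ∀ x ∈ convexHull ℝ (T : Set Plane), f x = MvPolynomial.eval (fun c => x c) P) ∧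
    ∀ x ∉ M.region, f x = 0}
  add_mem' := by
    rintro f g ⟨hf, hf', hf''⟩ ⟨hg, hg', hg''⟩
    refine ⟨hf.add hg, fun T hT => ?_, fun x hx => by simp [hf'' x hx, hg'' x hx]⟩
    obtain ⟨P, hP, hfP⟩ := hf' T hT
    obtain ⟨R, hR, hgR⟩ := hg' T hT
    exact ⟨P + R, (MvPolynomial.totalDegree_add P R).trans (max_le hP hR),
      fun x hx => by simp [hfP x hx, hgR x hx]⟩
  zero_mem' := ⟨continuousOn_const, fun T _ => ⟨0, by simp, fun x _ => by simp⟩, fun _ _ => rfl⟩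
  smul_mem' := by
    rintro c f ⟨hf, hf', hf''⟩
    refine ⟨hf.const_smul c, fun T hT => ?_, fun x hx => by simp [hf'' x hx]⟩
    obtain ⟨P, hP, hfP⟩ := hf' T hT
    exact ⟨c • P, (MvPolynomial.totalDegree_smul_le c P).trans hP,
      fun x hx => by simp [hfP x hx]⟩

/-- The `P2` velocity space: continuous piecewise quadratic vector fields that vanish on the
edges of `wall`. -/
def velocitySpace (M : TriMesh) (wall : Finset (Finset Plane)) : Submodule ℝ (Plane → Plane) where
  carrier := {v | (∀ c : Fin 2, (fun x => v x c) ∈ lagrangeSpace M 2) ∧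
    ∀ e ∈ wall, ∀ x ∈ convexHull ℝ (e : Set Plane), v x = 0}
  add_mem' := by
    rintro f g ⟨hf, hf'⟩ ⟨hg, hg'⟩
    exact ⟨fun c => (lagrangeSpace M 2).add_mem (hf c) (hg c),
      fun e he x hx => by simp [hf' e he x hx, hg' e he x hx]⟩
  zero_mem' := ⟨fun _ => (lagrangeSpace M 2).zero_mem, fun _ _ _ _ => rfl⟩
  smul_mem' := by
    rintro a f ⟨hf, hf'⟩
    exact ⟨fun c => (lagrangeSpace M 2).smul_mem a (hf c),
      fun e he x hx => by simp [hf' e he x hx]⟩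

/-- The `P1` pressure space: continuous piecewise affine functions. -/
def pressureSpace (M : TriMesh) : Submodule ℝ (Plane → ℝ) := lagrangeSpace M 1

/-- The partial derivative `∂ v_c / ∂ x_d`. -/
def partialDeriv (v : Plane → Plane) (c d : Fin 2) (x : Plane) : ℝ :=
  (fderiv ℝ v x (EuclideanSpace.single d 1)) c

/-- `a(u, v) = ν ∫_Ω ∇u : ∇v`. The integrand is the classical one inside each triangle, that is,
almost everywhere. -/
def formA (M : TriMesh) (ν : ℝ) (u v : Plane → Plane) : ℝ :=
  ν * ∫ x in M.region, ∑ c, ∑ d, partialDeriv u c d x * partialDeriv v c d x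

/-- `b(v, q) = - ∫_Ω q ∇·v`. -/
def formB (M : TriMesh) (v : Plane → Plane) (q : Plane → ℝ) : ℝ :=
  - ∫ x in M.region, q x * ∑ c, partialDeriv v c c x

/-! ### Decomposition into pores -/

/-- A polygonal pore domain partitioned into `N` triangulated pore subdomains, with `m` internal
interfaces and `mk` inlet/outlet pieces of the outer boundary. The meshes of neighbouring pores
need not match along their interface. -/
structure PoreDecomposition (N m mk : ℕ) where
  /-- the triangulated pore subdomains -/
  mesh : Fin N → TriMesh
  /-- the boundary edges of pore `i` on a given internal interface (`Sum.inl`) or inlet/outlet piece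
  (`Sum.inr`); the set is empty if the pore does not touch it -/
  face : Fin N → Fin m ⊕ Fin mk → Finset (Finset Plane)
  face_subset : ∀ i r, face i r ⊆ (mesh i).boundaryEdges
  face_disjoint : ∀ i r s, r ≠ s → Disjoint (face i r) (face i s)
  /-- the subdomains do not overlap -/
  nonoverlapping : ∀ i j, i ≠ j → Disjoint (interior (mesh i).region) (interior (mesh j).region)
  /-- every internal interface is shared by exactly two pores -/
  interface_two : ∀ α : Fin m, ∃ i j, i ≠ j ∧ ∀ l, (face l (Sum.inl α)).Nonempty ↔ l = i ∨ l = j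
  /-- which see it as the same subset of the plane -/
  interface_eq : ∀ (α : Fin m) (i j : Fin N),
    (face i (Sum.inl α)).Nonempty → (face j (Sum.inl α)).Nonempty →
      (⋃ e ∈ face i (Sum.inl α), convexHull ℝ (e : Set Plane)) =
        ⋃ e ∈ face j (Sum.inl α), convexHull ℝ (e : Set Plane)
  /-- all other boundary edges lie on the boundary of the whole domain -/
  exterior_subset : ∀ i, ∀ e ∈ (mesh i).boundaryEdges, (∀ α : Fin m, e ∉ face i (Sum.inl α)) →
    convexHull ℝ (e : Set Plane) ⊆ frontier (⋃ j, (mesh j).region)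

namespace PoreDecomposition

variable {N m mk : ℕ} (D : PoreDecomposition N m mk)

open scoped Classical in
/-- The no-slip wall of pore `i`: the boundary edges on no face. -/
def wall (i : Fin N) : Finset (Finset Plane) :=
  (D.mesh i).boundaryEdges.filter fun e => ∀ r, e ∉ D.face i r

open scoped Classical in
/-- The boundary edges of pore `i` on the boundary of the whole domain: no-slip wall and
inlet/outlet edges. -/
def exteriorEdges (i : Fin N) : Finset (Finset Plane) :=
  (D.mesh i).boundaryEdges.filter fun e => ∀ α : Fin m, e ∉ D.face i (Sum.inl α)

/-- The internal faces of pore `i` (unknown traction). The map `β_i^u` into the global list of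
interfaces is the coercion `Subtype.val`. -/
abbrev UFace (i : Fin N) : Type := {α : Fin m // (D.face i (Sum.inl α)).Nonempty}

/-- The inlet/outlet faces of pore `i` (known traction), with `β_i^k` the coercion. -/
abbrev KFace (i : Fin N) : Type := {k : Fin mk // (D.face i (Sum.inr k)).Nonempty}

/-- The faces of pore `i`. -/
abbrev LFace (i : Fin N) : Type := D.UFace i ⊕ D.KFace i

/-- The boundary edges which form the face `r` of pore `i`. -/
def faceEdges (i : Fin N) (r : D.LFace i) : Finset (Finset Plane) :=
  D.face i (Sum.map Subtype.val Subtype.val r)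

/-- The outward flux `∫_{Γ_{i,r}} v · n_{i,r}`. -/
def faceFlux (i : Fin N) (r : D.LFace i) (v : Plane → Plane) : ℝ :=
  ∑ e ∈ D.faceEdges i r, (D.mesh i).edgeFlux v e

/-- Two pores are adjacent if they share an internal interface. -/
def Adjacent (i j : Fin N) : Prop :=
  i ≠ j ∧ ∃ α : Fin m, (D.face i (Sum.inl α)).Nonempty ∧ (D.face j (Sum.inl α)).Nonempty

/-- The discrete velocity space of pore `i`. -/
abbrev V (i : Fin N) : Submodule ℝ (Plane → Plane) := velocitySpace (D.mesh i) (D.wall i)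

/-- The discrete pressure space of pore `i`. -/
abbrev Q (i : Fin N) : Submodule ℝ (Plane → ℝ) := pressureSpace (D.mesh i)

/-- The Boolean restriction matrix `R_i^u`. -/
def Ru (i : Fin N) : Matrix (D.UFace i) (Fin m) ℝ :=
  Matrix.of fun r α => if r.1 = α then 1 else 0

/-- The Boolean restriction matrix `R_i^k`. -/
def Rk (i : Fin N) : Matrix (D.KFace i) (Fin mk) ℝ :=
  Matrix.of fun s k => if s.1 = k then 1 else 0

/-! ### Local matrices, with respect to a basis `φ` of velocities and a basis `ψ` of pressures -/

section Local

variable (ν : ℝ) (i : Fin N) {ι κ : Type*} [Fintype ι] [DecidableEq ι] [Fintype κ] [DecidableEq κ]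
  (φ : Module.Basis ι ℝ (D.V i)) (ψ : Module.Basis κ ℝ (D.Q i))

/-- `A_{jk} = a(φ_k, φ_j)`. -/
def matA : Matrix ι ι ℝ := Matrix.of fun j k => formA (D.mesh i) ν (φ k : Plane → Plane) (φ j)

/-- `B_{lj} = b(φ_j, ψ_l)`. -/
def matB : Matrix κ ι ℝ := Matrix.of fun l j => formB (D.mesh i) (φ j : Plane → Plane) (ψ l)

/-- The load vector of a unit normal traction on face `r`: `f_j = - ∫_{Γ_{i,r}} φ_j · n`. -/
def load (r : D.LFace i) : ι → ℝ := fun j => - D.faceFlux i r (φ j : Plane → Plane)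

/-- The saddle-point matrix `[A Bᵀ; B 0]` of the local Stokes problem. -/
def matK : Matrix (ι ⊕ κ) (ι ⊕ κ) ℝ :=
  Matrix.fromBlocks (D.matA ν i φ) (D.matB i φ ψ)ᵀ (D.matB i φ ψ) 0

/-- The velocity coefficients of the response to a unit normal traction on face `r`: the first
block of the solution of `[A Bᵀ; B 0] [f̃; X] = [f; 0]`. -/
def response (r : D.LFace i) : ι → ℝ :=
  fun j => ((D.matK ν i φ ψ)⁻¹ *ᵥ Sum.elim (D.load i φ r) (0 : κ → ℝ)) (Sum.inl j)

/-- The local discrete Dirichlet-to-Neumann matrix. -/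
def matG : Matrix (D.LFace i) (D.LFace i) ℝ :=
  Matrix.of fun k r => - (D.load i φ k ⬝ᵥ D.response ν i φ ψ r)

/-- The local traction vector `(R_i^u p, R_i^k pᵏ)`. -/
def localTraction (pk : Fin mk → ℝ) (p : Fin m → ℝ) : D.LFace i → ℝ :=
  Sum.elim (D.Ru i *ᵥ p) (D.Rk i *ᵥ pk)

/-- The velocity field `u_i^h` reconstructed from the global traction vectors. -/
def velocity (pk : Fin mk → ℝ) (p : Fin m → ℝ) : Plane → Plane :=
  ∑ j, (∑ r, D.localTraction i pk p r * D.response ν i φ ψ r j) • (φ j : Plane → Plane)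

end Local

/-! ### The global interface system -/

section Global

variable (ν : ℝ) {ι κ : Fin N → Type*} [∀ i, Fintype (ι i)] [∀ i, DecidableEq (ι i)]
  [∀ i, Fintype (κ i)] [∀ i, DecidableEq (κ i)]
  (φ : ∀ i, Module.Basis (ι i) ℝ (D.V i)) (ψ : ∀ i, Module.Basis (κ i) ℝ (D.Q i))

/-- The Schur complement `S = - ∑ i, (R_i^u)ᵀ G_i^{uu} R_i^u`. -/
def schur : Matrix (Fin m) (Fin m) ℝ :=
  - ∑ i, (D.Ru i)ᵀ * (D.matG ν i (φ i) (ψ i)).toBlocks₁₁ * D.Ru i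

/-- The forcing vector `F = ∑ i, (R_i^u)ᵀ G_i^{uk} R_i^k pᵏ`. -/
def forcing (pk : Fin mk → ℝ) : Fin m → ℝ :=
  ∑ i, ((D.Ru i)ᵀ * (D.matG ν i (φ i) (ψ i)).toBlocks₁₂ * D.Rk i) *ᵥ pk

end Global

/-- The net flux `∫_{∂Ω} u · n` of a field given on each pore `i` by `u i`. -/
def netFlux (u : Fin N → Plane → Plane) : ℝ :=
  ∑ i, ∑ e ∈ D.exteriorEdges i, (D.mesh i).edgeFlux (u i) e

end PoreDecomposition

end DDPNM

end

noncomputable section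

namespace DDPNM

/-! ### Integrals over segments and triangles -/

/-! Two local kernel statements and one energy identity carry the proof. A velocity with vanishing
`formA` energy is constant on each triangle, hence constant on the edge-connected pore, hence zero
because the wall contains an edge (`eq_zero_of_formA_eq_zero`). A pressure orthogonal to the
divergences of all velocities that vanish on the boundary is constant
(`exists_const_of_formB_eq_zero`, the kernel form of Taylor-Hood stability); the test velocities are
quadratic edge bubbles. A bubble on a boundary edge of a face compares this constant with the
traction there, so tractions balanced by a pressure alone all equal one constant
(`exists_const_of_balance`). For zero tractions and at least one face the pressure is therefore
zero, and `isUnit_saddleMatrix` gives local solvability.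

Let `u_s`, `u_t` be the responses to tractions `s`, `t`. Testing the momentum equation of `u_s` with
`u_t` removes the pressure, since `u_t` is discretely divergence free, and leaves `s · G t = -a(u_s,
u_t)` (`dotProduct_matG_mulVec`). Hence `G` is symmetric and `x · S x` is the sum of the local
energies with zero inlet/outlet tractions. If it vanishes, nothing flows, the tractions on the faces
of each pore equal one constant, neighbouring pores share this constant, and it is zero where there
is an inlet/outlet; so `x = 0` (`eq_zero_of_tractionField_eq_zero`).

For mass conservation, the constant 1 is a discrete pressure, so the divergence theorem turns
discrete incompressibility into zero total flux per pore. The residual `F - S p` is the vector of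
flux imbalances at the interfaces (`forcing_sub_schur_mulVec`); when it vanishes the internal fluxes
cancel and nothing is left for the outer boundary. The divergence theorem comes from the fundamental
theorem of calculus along two edges of a triangle, and from cancellation across interior edges:
conformity puts the two triangles on opposite sides. -/

/-- The cross product of two plane vectors. -/
def cross (u v : Plane) : ℝ := u 0 * v 1 - u 1 * v 0

/-- Arc length parametrization is an isometry of the line into the plane, so it carries Lebesgue
measure to the one-dimensional Hausdorff measure on its range; rescaling to the unit interval gives
the factor `‖b - a‖`. For `a = b` both sides are zero. -/
lemma setIntegral_segment (a b : Plane) (f : Plane → ℝ) :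
    ∫ x in segment ℝ a b, f x ∂(μH[1]) = ‖b - a‖ * ∫ t in (0 : ℝ)..1, f (a + t • (b - a)) := by
  rcases eq_or_ne a b with rfl | hab
  · have : Measure.restrict (μH[1] : Measure Plane) {a} = 0 := by
      rw [Measure.restrict_eq_zero]
      simpa using hausdorffMeasure_segment a a
    simp [this]
  have hL : 0 < ‖b - a‖ := norm_pos_iff.2 (sub_ne_zero.2 hab.symm)
  set L := ‖b - a‖ with hLdef
  let F : ℝ → Plane := fun t => a + t • (L⁻¹ • (b - a))
  have hF : Isometry F := by
    refine Isometry.of_dist_eq fun s t => ?_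
    rw [dist_eq_norm, dist_eq_norm, add_sub_add_left_eq_sub, ← sub_smul, norm_smul, norm_smul,
      norm_inv, ← hLdef, Real.norm_of_nonneg hL.le, inv_mul_cancel₀ hL.ne', mul_one]
  have himg : F '' Set.Icc 0 L = segment ℝ a b := by
    rw [segment_eq_image']
    ext x
    constructor
    · rintro ⟨t, ⟨h0, h1⟩, rfl⟩
      exact ⟨t * L⁻¹, ⟨by positivity, by rw [← div_eq_mul_inv]; exact (div_le_one hL).2 h1⟩,
        by simp [F, smul_smul]⟩
    · rintro ⟨t, ⟨h0, h1⟩, rfl⟩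
      refine ⟨t * L, ⟨by positivity, by nlinarith⟩, ?_⟩
      simp [F, smul_smul, mul_assoc, mul_inv_cancel₀ hL.ne']
  have hemb : MeasurableEmbedding F := hF.isClosedEmbedding.measurableEmbedding
  have hmap : Measure.map F volume = (μH[1] : Measure Plane).restrict (Set.range F) := by
    rw [← hausdorffMeasure_real]
    exact hF.map_hausdorffMeasure (Or.inl zero_le_one)
  have hr : (μH[1] : Measure Plane).restrict (segment ℝ a b)
      = (Measure.map F volume).restrict (segment ℝ a b) := by
    rw [hmap, Measure.restrict_restrict_of_subset]
    rw [← himg]; exact Set.image_subset_range _ _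
  rw [hr, hemb.setIntegral_map, ← himg, hF.injective.preimage_image, integral_Icc_eq_integral_Ioc,
    ← intervalIntegral.integral_of_le hL.le]
  have := intervalIntegral.integral_comp_mul_left (a := 0) (b := 1) (fun t => f (F t)) hL.ne'
  simp only [mul_zero, mul_one, smul_eq_mul] at this
  have h2 : ∀ t : ℝ, F (L * t) = a + t • (b - a) := fun t => by
    simp only [F, smul_smul]
    rw [mul_right_comm, mul_inv_cancel₀ hL.ne', one_mul]
  simp only [h2] at this
  rw [this, mul_inv_cancel_left₀ hL.ne']

lemma convexHull_triple (a b c : Plane) :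
    convexHull ℝ {a, b, c} =
      (fun x : Plane => a + (x 0 • (b - a) + x 1 • (c - a))) ''
        {x : Plane | 0 ≤ x 0 ∧ 0 ≤ x 1 ∧ x 0 + x 1 ≤ 1} := by
  rw [convexHull_insert (by simp), convexHull_pair]
  ext x
  simp only [mem_convexJoin, Set.mem_singleton_iff, exists_eq_left, segment_eq_image', Set.mem_image,
    Set.mem_Icc, Set.mem_ofPred_eq]
  constructor
  · rintro ⟨_, ⟨s, ⟨hs0, hs1⟩, rfl⟩, t, ⟨ht0, ht1⟩, rfl⟩
    refine ⟨!₂[t * (1 - s), t * s], ?_, ?_⟩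
    · simp only [Matrix.cons_val_zero, Matrix.cons_val_one]
      exact ⟨mul_nonneg ht0 (by linarith), by positivity, by linarith⟩
    · simp only [Matrix.cons_val_zero, Matrix.cons_val_one]
      module
  · rintro ⟨y, ⟨h0, h1, h2⟩, rfl⟩
    rcases eq_or_ne (y 0 + y 1) 0 with h | h
    · have e0 : y 0 = 0 := by linarith
      have e1 : y 1 = 0 := by linarith
      exact ⟨b, ⟨0, by simp, by simp⟩, 0, by simp, by simp [e0, e1]⟩
    -- The ray from `a` through the point meets the side `bc` at parameter `y 1 / (y 0 + y 1)`, and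
    -- the point divides that segment at `y 0 + y 1`.
    · refine ⟨_, ⟨y 1 / (y 0 + y 1), ⟨by positivity, ?_⟩, rfl⟩, y 0 + y 1, ⟨by positivity, h2⟩, ?_⟩
      · exact div_le_one_of_le₀ (by linarith) (by linarith)
      · have : (y 0 + y 1) * (y 1 / (y 0 + y 1)) = y 1 := by field_simp
        have e : (y 0 + y 1) • (b + (y 1 / (y 0 + y 1)) • (c - b) - a)
            = (y 0 + y 1) • (b - a) + ((y 0 + y 1) * (y 1 / (y 0 + y 1))) • (c - b) := by module
        rw [e, this]
        module

/-- The linear map with columns `u`, `v`. -/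
def columns (u v : Plane) : Plane →L[ℝ] Plane :=
  (EuclideanSpace.proj (0 : Fin 2) : Plane →L[ℝ] ℝ).smulRight u +
    (EuclideanSpace.proj (1 : Fin 2) : Plane →L[ℝ] ℝ).smulRight v

@[simp] lemma columns_apply (u v x : Plane) : columns u v x = x 0 • u + x 1 • v := by
  simp [columns]

lemma det_columns (u v : Plane) : (columns u v).det = cross u v := by
  rw [ContinuousLinearMap.det, ← LinearMap.det_toMatrix (EuclideanSpace.basisFun (Fin 2) ℝ).toBasis,
    Matrix.det_fin_two]
  simp [LinearMap.toMatrix_apply, cross]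
  ring

lemma injective_columns {u v : Plane} (h : cross u v ≠ 0) : Function.Injective (columns u v) := by
  have : IsUnit (LinearMap.det (columns u v : Plane →ₗ[ℝ] Plane)) := by
    rw [isUnit_iff_ne_zero]; rwa [← det_columns] at h
  exact (LinearMap.isUnit_iff_ker_eq_bot _).1 ((LinearMap.isUnit_iff_isUnit_det _).2 this) |>
    LinearMap.ker_eq_bot.1

/-- The reference triangle. -/
def refTriangle : Set (ℝ × ℝ) := {x | 0 ≤ x.1 ∧ 0 ≤ x.2 ∧ x.1 + x.2 ≤ 1}

lemma isClosed_refTriangle : IsClosed refTriangle :=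
  (isClosed_le continuous_const continuous_fst).inter
    ((isClosed_le continuous_const continuous_snd).inter
      (isClosed_le (continuous_fst.add continuous_snd) continuous_const))

lemma isCompact_refTriangle : IsCompact refTriangle :=
  (isCompact_Icc (a := ((0 : ℝ), (0 : ℝ))) (b := (1, 1))).of_isClosed_subset isClosed_refTriangle
    fun x hx => ⟨⟨hx.1, hx.2.1⟩, ⟨by have := hx.2.2; have := hx.2.1; simp; linarith,
      by have := hx.2.2; have := hx.1; simp; linarith⟩⟩

lemma setIntegral_refTriangle {f : ℝ × ℝ → ℝ} (hf : Continuous f) :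
    ∫ x in refTriangle, f x = ∫ t in (0 : ℝ)..1, ∫ s in (0 : ℝ)..(1 - t), f (s, t) := by
  have hm : MeasurableSet refTriangle := isClosed_refTriangle.measurableSet
  rw [← integral_indicator hm, Measure.volume_eq_prod, integral_prod_symm]
  · rw [intervalIntegral.integral_of_le zero_le_one, ← integral_Icc_eq_integral_Ioc,
      ← integral_indicator measurableSet_Icc]
    congr 1 with t
    by_cases ht : t ∈ Set.Icc (0 : ℝ) 1
    · rw [Set.indicator_of_mem ht, intervalIntegral.integral_of_le (by linarith [ht.2]),
        ← integral_Icc_eq_integral_Ioc, ← integral_indicator measurableSet_Icc]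
      congr 1 with s
      by_cases hs : s ∈ Set.Icc (0 : ℝ) (1 - t)
      · rw [Set.indicator_of_mem hs, Set.indicator_of_mem]
        exact ⟨hs.1, ht.1, by simpa using by linarith [hs.2]⟩
      · rw [Set.indicator_of_notMem hs, Set.indicator_of_notMem]
        intro h
        exact hs ⟨h.1, by have := h.2.2; simp at this; linarith⟩
    · rw [Set.indicator_of_notMem ht, ← integral_zero ℝ ℝ]
      congr 1 with s
      rw [Set.indicator_of_notMem]
      intro h
      exact ht ⟨h.2.1, by have := h.2.2; have := h.1; simp at *; linarith⟩
  · rw [← Measure.volume_eq_prod, integrable_indicator_iff hm]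
    exact hf.continuousOn.integrableOn_compact isCompact_refTriangle

/-- The triangle is an injective affine image of the reference triangle with constant Jacobian. No
regularity of `f` is needed for this change of variables. -/
lemma setIntegral_triangle (a b c : Plane) (h : cross (b - a) (c - a) ≠ 0) (f : Plane → ℝ) :
    ∫ x in convexHull ℝ {a, b, c}, f x = |cross (b - a) (c - a)| *
      ∫ x in refTriangle, f (a + (x.1 • (b - a) + x.2 • (c - a))) := by
  set R : Set Plane := {x : Plane | 0 ≤ x 0 ∧ 0 ≤ x 1 ∧ x 0 + x 1 ≤ 1}
  have hR : MeasurableSet R := by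
    have h1 : IsClosed {x : Plane | 0 ≤ x 0} := isClosed_le (by fun_prop) (by fun_prop)
    have h2 : IsClosed {x : Plane | 0 ≤ x 1} := isClosed_le (by fun_prop) (by fun_prop)
    have h3 : IsClosed {x : Plane | x 0 + x 1 ≤ 1} := isClosed_le (by fun_prop) (by fun_prop)
    exact (h1.inter (h2.inter h3)).measurableSet
  have key := integral_image_eq_integral_abs_det_fderiv_smul (μ := volume) hR
    (f := fun x : Plane => a + (x 0 • (b - a) + x 1 • (c - a)))
    (f' := fun _ => columns (b - a) (c - a))
    (fun x _ => by
      have := ((columns (b - a) (c - a)).hasFDerivAt (x := x)).const_add a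
      simpa using this.hasFDerivWithinAt)
    (fun x _ y _ hxy => injective_columns h (by simpa using hxy)) f
  rw [convexHull_triple, key]
  simp only [det_columns, smul_eq_mul]
  rw [integral_const_mul]
  congr 1
  have e := (volume_preserving_finTwoArrow ℝ).comp
    (EuclideanSpace.volume_preserving_symm_measurableEquiv_toLp (Fin 2))
  have := e.setIntegral_preimage_emb
    ((MeasurableEquiv.finTwoArrow (α := ℝ)).measurableEmbedding.comp
      (MeasurableEquiv.toLp 2 (Fin 2 → ℝ)).symm.measurableEmbedding)
    (fun x : ℝ × ℝ => f (a + (x.1 • (b - a) + x.2 • (c - a)))) refTriangle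
  rw [← this]
  rfl

/-- The fundamental theorem of calculus on a triangle, in the direction of one of its edges. -/
lemma setIntegral_triangle_fderiv (a b c : Plane) (h : cross (b - a) (c - a) ≠ 0) {g : Plane → ℝ}
    (hg : ContDiff ℝ 1 g) :
    ∫ x in convexHull ℝ {a, b, c}, fderiv ℝ g x (b - a) = |cross (b - a) (c - a)| *
      ((∫ t in (0 : ℝ)..1, g (b + t • (c - b))) - ∫ t in (0 : ℝ)..1, g (a + t • (c - a))) := by
  have hc : Continuous fun x => fderiv ℝ g x (b - a) :=
    (hg.continuous_fderiv one_ne_zero).clm_apply continuous_const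
  rw [setIntegral_triangle a b c h]
  congr 1
  rw [setIntegral_refTriangle (f := fun x => fderiv ℝ g (a + (x.1 • (b - a) + x.2 • (c - a))) (b - a))
    (hc.comp (by fun_prop)), ← intervalIntegral.integral_sub]
  · refine intervalIntegral.integral_congr fun t _ => ?_
    -- For fixed `t` the inner integral is that of a derivative in `s`; its endpoints `s = 1 - t`
    -- and `s = 0` lie on the edges `bc` and `ac`.
    have hd : ∀ s : ℝ, HasDerivAt (fun s : ℝ => g (a + (s • (b - a) + t • (c - a))))
        (fderiv ℝ g (a + (s • (b - a) + t • (c - a))) (b - a)) s := fun s => by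
      have h1 : HasDerivAt (fun s : ℝ => a + (s • (b - a) + t • (c - a))) (b - a) s := by
        simpa using (((hasDerivAt_id s).smul_const (b - a)).add_const (t • (c - a))).const_add a
      exact ((hg.differentiable one_ne_zero _).hasFDerivAt).comp_hasDerivAt s h1
    simp only
    rw [intervalIntegral.integral_eq_sub_of_hasDerivAt (fun s _ => hd s)]
    · congr 2
      · module
      · module
    · exact (hc.comp (by fun_prop)).intervalIntegrable _ _
  · exact (hg.continuous.comp (by fun_prop)).intervalIntegrable _ _
  · exact (hg.continuous.comp (by fun_prop)).intervalIntegrable _ _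

/-! ### Normals and fluxes of a triangle -/

/-- Rotation by a right angle. -/
def rot (u : Plane) : Plane := !₂[-u 1, u 0]

lemma inner_plane (u v : Plane) : inner ℝ u v = u 0 * v 0 + u 1 * v 1 := by
  simp [PiLp.inner_apply, Fin.sum_univ_two, mul_comm]

lemma inner_rot_right (u v : Plane) : inner ℝ v (rot u) = cross u v := by
  simp [inner_plane, rot, cross]; ring

lemma norm_sq_plane (u : Plane) : ‖u‖ ^ 2 = u 0 ^ 2 + u 1 ^ 2 := by
  simp [EuclideanSpace.norm_sq_eq, Fin.sum_univ_two]

lemma norm_rot (u : Plane) : ‖rot u‖ = ‖u‖ := by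
  rw [← sq_eq_sq₀ (norm_nonneg _) (norm_nonneg _), norm_sq_plane, norm_sq_plane]
  simp [rot]; ring

lemma cross_rot_self (u : Plane) : cross u (rot u) = ‖u‖ ^ 2 := by
  rw [norm_sq_plane]; simp [cross, rot]; ring

lemma cross_self (u : Plane) : cross u u = 0 := by simp [cross]; ring

lemma cross_swap (u v : Plane) : cross u v = -cross v u := by simp [cross]; ring

lemma cross_smul (u v : Plane) (r : ℝ) : cross u (r • v) = r * cross u v := by simp [cross]; ring

lemma cross_add (u v w : Plane) : cross u (v + w) = cross u v + cross u w := by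
  simp [cross]; ring

/-- Expansion in the orthogonal frame `u`, `rot u`, multiplied by `‖u‖ ^ 2` so that `u = 0` is
allowed. -/
lemma norm_sq_smul_eq (u v : Plane) :
    ‖u‖ ^ 2 • v = inner ℝ u v • u + cross u v • rot u := by
  rw [norm_sq_plane, inner_plane]
  ext i
  fin_cases i <;> simp [rot, cross] <;> ring

-- The vector from centroid to midpoint is `u / 6 - (c - a) / 3` with `u = b - a`. Projection kills
-- its `u` component and leaves `-δ / (3 ‖u‖ ^ 2)` times `rot u`, so after normalization only the
-- sign of `δ = cross u (c - a)`, the orientation of the triangle, survives.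
open scoped Classical in
lemma outwardNormal_eq {a b c : Plane} (h : cross (b - a) (c - a) ≠ 0) :
    outwardNormal {a, b, c} {a, b} =
      -((|cross (b - a) (c - a)|⁻¹ * cross (b - a) (c - a)) * ‖b - a‖⁻¹) • rot (b - a) := by
  set u := b - a with hu
  set δ := cross u (c - a) with hδ
  have hu0 : u ≠ 0 := by
    rintro h0
    apply h
    rw [hδ, h0]
    simp [cross]
  have hab : a ≠ b := fun e => hu0 (by rw [hu, e, sub_self])
  have hca : c ≠ a := by
    rintro rfl
    apply h; rw [hδ]; simp [cross]
  have hcb : c ≠ b := by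
    rintro rfl
    apply h; rw [hδ]; exact cross_self u
  have hn : 0 < ‖u‖ := norm_pos_iff.2 hu0
  have hspan : vectorSpan ℝ ((({a, b} : Finset Plane)) : Set Plane) = Submodule.span ℝ {u} := by
    rw [Finset.coe_pair, vectorSpan_pair_rev]; simp [hu]
  have hm : (1 / 2 : ℝ) • ∑ x ∈ ({a, b} : Finset Plane), x -
      (1 / 3 : ℝ) • ∑ x ∈ ({a, b, c} : Finset Plane), x
      = (1 / 6 - (1 / 3) * (inner ℝ u (c - a) / ‖u‖ ^ 2)) • u +
        (-(1 / 3) * (δ / ‖u‖ ^ 2)) • rot u := by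
    rw [Finset.sum_pair hab, Finset.sum_insert (by simp [hab, hca.symm]),
      Finset.sum_pair (by exact hcb.symm)]
    have h1 : c - a = (inner ℝ u (c - a) / ‖u‖ ^ 2) • u + (δ / ‖u‖ ^ 2) • rot u := by
      have := norm_sq_smul_eq u (c - a)
      have h2 : c - a = (‖u‖ ^ 2)⁻¹ • (‖u‖ ^ 2 • (c - a)) := by
        rw [inv_smul_smul₀ (by positivity)]
      rw [this, smul_add, smul_smul, smul_smul, ← div_eq_inv_mul, ← div_eq_inv_mul] at h2
      exact h2
    have h3 : (1 / 2 : ℝ) • (a + b) - (1 / 3 : ℝ) • (a + (b + c)) =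
        (1 / 6 : ℝ) • u - (1 / 3 : ℝ) • (c - a) := by
      rw [hu]; module
    rw [h3]
    nth_rewrite 1 [h1]
    module
  have hperp : rot u ∈ (Submodule.span ℝ {u})ᗮ := by
    rw [Submodule.mem_orthogonal_singleton_iff_inner_right, inner_rot_right, cross_self]
  have hw : (Submodule.span ℝ {u})ᗮ.starProjection
      ((1 / 2 : ℝ) • ∑ x ∈ ({a, b} : Finset Plane), x -
        (1 / 3 : ℝ) • ∑ x ∈ ({a, b, c} : Finset Plane), x) = (-(1 / 3) * (δ / ‖u‖ ^ 2)) • rot u := by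
    rw [hm, map_add, map_smul, map_smul, Submodule.starProjection_eq_self_iff.2 hperp,
      Submodule.starProjection_orthogonal_apply_eq_zero (Submodule.mem_span_singleton_self u)]
    simp
  simp only [outwardNormal, hspan, hw]
  rw [norm_smul, norm_rot, smul_smul]
  congr 1
  have : ‖-(1 / 3) * (δ / ‖u‖ ^ 2)‖ = (1 / 3) * (|δ| / ‖u‖ ^ 2) := by
    rw [norm_mul, norm_neg, norm_div δ, Real.norm_eq_abs δ, Real.norm_of_nonneg (by positivity),
      Real.norm_of_nonneg (by positivity)]
  rw [this]
  have hd : |δ| ≠ 0 := abs_ne_zero.2 h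
  field_simp

/-- The flux through the edge `e` out of the triangle `T`. -/
def triFlux (T e : Finset Plane) (v : Plane → Plane) : ℝ :=
  ∫ x in convexHull ℝ (e : Set Plane), inner ℝ (v x) (outwardNormal T e) ∂(μH[1])

-- The length factor of the arc length integral cancels the normalization of the normal. What
-- remains is an interval integral with an orientation sign, in which opposite sides of an edge
-- differ only by that sign.
open scoped Classical in
lemma triFlux_eq {a b c : Plane} (h : cross (b - a) (c - a) ≠ 0) (v : Plane → Plane) :
    triFlux {a, b, c} {a, b} v = -(|cross (b - a) (c - a)|⁻¹ * cross (b - a) (c - a)) *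
      ∫ t in (0 : ℝ)..1, cross (b - a) (v (a + t • (b - a))) := by
  have hn : ‖b - a‖ ≠ 0 := by
    rw [norm_ne_zero_iff]
    intro h0
    exact h (by rw [h0]; simp [cross])
  rw [triFlux, Finset.coe_pair, convexHull_pair, outwardNormal_eq h, setIntegral_segment]
  simp only [inner_smul_right, inner_rot_right]
  rw [intervalIntegral.integral_const_mul]
  field_simp

open scoped Classical in
lemma sum_powersetCard_two {a b c : Plane} (hab : a ≠ b) (hac : a ≠ c) (hbc : b ≠ c)
    (f : Finset Plane → ℝ) :
    ∑ e ∈ ({a, b, c} : Finset Plane).powersetCard 2, f e = f {a, b} + f {b, c} + f {c, a} := by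
  have h : ({a, b, c} : Finset Plane).powersetCard 2 = {{a, b}, {b, c}, {c, a}} := by
    ext e
    rw [Finset.mem_powersetCard]
    constructor
    · rintro ⟨h1, h2⟩
      obtain ⟨x, y, hxy, rfl⟩ := Finset.card_eq_two.1 h2
      have hx := h1 (Finset.mem_insert_self x {y})
      have hy := h1 (Finset.mem_insert_of_mem (Finset.mem_singleton_self y))
      simp only [Finset.mem_insert, Finset.mem_singleton] at hx hy ⊢
      rcases hx with rfl | rfl | rfl <;> rcases hy with rfl | rfl | rfl <;>
        simp_all [Finset.pair_comm]
    · simp only [Finset.mem_insert, Finset.mem_singleton]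
      rintro (rfl | rfl | rfl)
      · exact ⟨by intro x; simp only [Finset.mem_insert, Finset.mem_singleton]; tauto, Finset.card_pair hab⟩
      · exact ⟨by intro x; simp only [Finset.mem_insert, Finset.mem_singleton]; tauto, Finset.card_pair hbc⟩
      · exact ⟨by intro x; simp only [Finset.mem_insert, Finset.mem_singleton]; tauto, Finset.card_pair hac.symm⟩
  have mem_ne : ∀ {x : Plane} {s t : Finset Plane}, x ∈ s → x ∉ t → s ≠ t := by
    rintro x s t h1 h2 rfl; exact h2 h1
  rw [h, Finset.sum_insert, Finset.sum_pair, add_assoc]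
  · exact mem_ne (x := b) (by simp) (by simp [hbc, hab.symm])
  · simp only [Finset.mem_insert, Finset.mem_singleton, not_or]
    exact ⟨mem_ne (x := a) (by simp) (by simp [hab, hac]),
      mem_ne (x := b) (by simp) (by simp [hbc, hab.symm])⟩

/-- The trace is the derivative of the determinant. With `L` the derivative of a field, this writes
the divergence through directional derivatives along two edges. -/
lemma cross_mul_trace (L : Plane →L[ℝ] Plane) (u w : Plane) :
    cross u w * ∑ c, (L (EuclideanSpace.single c 1)) c = cross (L u) w + cross u (L w) := by
  have key : ∀ x : Plane, L x = x 0 • L (EuclideanSpace.single 0 1) +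
      x 1 • L (EuclideanSpace.single 1 1) := fun x => by
    rw [← map_smul, ← map_smul, ← map_add]
    congr 1
    ext i; fin_cases i <;> simp
  rw [key u, key w, Fin.sum_univ_two]
  simp [cross]; ring

lemma contDiff_cross_right {v : Plane → Plane} (hv : ContDiff ℝ 1 v) (u : Plane) :
    ContDiff ℝ 1 fun x => cross u (v x) := by
  unfold cross
  have h (i : Fin 2) : ContDiff ℝ 1 fun x => v x i :=
    (EuclideanSpace.proj i : Plane →L[ℝ] ℝ).contDiff.comp hv
  exact (contDiff_const.mul (h 1)).sub (contDiff_const.mul (h 0))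

lemma fderiv_cross_right {v : Plane → Plane} (hv : ContDiff ℝ 1 v) (u x d : Plane) :
    fderiv ℝ (fun x => cross u (v x)) x d = cross u (fderiv ℝ v x d) := by
  have hd := ((hv.differentiable one_ne_zero) x).hasFDerivAt
  have h (i : Fin 2) : HasFDerivAt (fun x => v x i)
      ((EuclideanSpace.proj i : Plane →L[ℝ] ℝ).comp (fderiv ℝ v x)) x :=
    (EuclideanSpace.proj i : Plane →L[ℝ] ℝ).hasFDerivAt.comp x hd
  have := ((h 1).const_mul (u 0)).sub ((h 0).const_mul (u 1))
  refine (congrArg (fun L : Plane →L[ℝ] ℝ => L d) this.fderiv).trans ?_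
  simp [cross]

open scoped Classical in
/-- The divergence theorem on a triangle. -/
theorem setIntegral_triangle_div {a b c : Plane} (h : cross (b - a) (c - a) ≠ 0)
    (hab : a ≠ b) (hac : a ≠ c) (hbc : b ≠ c) {v : Plane → Plane} (hv : ContDiff ℝ 1 v) :
    ∫ x in convexHull ℝ {a, b, c}, ∑ d, partialDeriv v d d x =
      ∑ e ∈ ({a, b, c} : Finset Plane).powersetCard 2, triFlux {a, b, c} e v := by
  set δ := cross (b - a) (c - a) with hδ
  have hδ₁ : cross (c - b) (a - b) = δ := by simp [hδ, cross]; ring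
  have hδ₂ : cross (a - c) (b - c) = δ := by simp [hδ, cross]; ring
  have hδ₃ : cross (c - a) (b - a) = -δ := by simp [hδ, cross]; ring
  have e₁ : ({a, b, c} : Finset Plane) = {b, c, a} := by
    ext; simp only [Finset.mem_insert, Finset.mem_singleton]; tauto
  have e₂ : ({a, b, c} : Finset Plane) = {c, a, b} := by
    ext; simp only [Finset.mem_insert, Finset.mem_singleton]; tauto
  have f₁ : triFlux {a, b, c} {b, c} v = _ := e₁ ▸ triFlux_eq (a := b) (b := c) (c := a)
    (by rw [hδ₁]; exact h) v
  have f₂ : triFlux {a, b, c} {c, a} v = _ := e₂ ▸ triFlux_eq (a := c) (b := a) (c := b)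
    (by rw [hδ₂]; exact h) v
  rw [sum_powersetCard_two hab hac hbc, triFlux_eq h, f₁, f₂, hδ₁, hδ₂, ← hδ]
  have hsegInt (u x y : Plane) :
      IntervalIntegrable (fun t : ℝ => cross u (v (x + t • (y - x)))) volume 0 1 :=
    ((contDiff_cross_right hv u).continuous.comp (by fun_prop)).intervalIntegrable _ _
  have g₁ := setIntegral_triangle_fderiv a b c h (contDiff_cross_right hv (c - a))
  have g₂ := setIntegral_triangle_fderiv a c b (by rw [hδ₃]; exact neg_ne_zero.2 h)
    (contDiff_cross_right hv (b - a))
  rw [show ({a, c, b} : Set Plane) = {a, b, c} by rw [Set.pair_comm c b]] at g₂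
  simp only [fderiv_cross_right hv] at g₁ g₂
  rw [hδ₃, abs_neg] at g₂
  rw [← hδ] at g₁
  have hcomp : IsCompact (convexHull ℝ ({a, b, c} : Set Plane)) :=
    (Set.toFinite _).isCompact_convexHull ℝ
  have hci (u d : Plane) : IntegrableOn (fun x => cross u (fderiv ℝ v x d))
      (convexHull ℝ ({a, b, c} : Set Plane)) := by
    have h1 : Continuous fun x => cross u (fderiv ℝ v x d) := by
      have h2 : Continuous fun x => fderiv ℝ v x d :=
        (hv.continuous_fderiv one_ne_zero).clm_apply continuous_const
      unfold cross
      fun_prop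
    exact h1.continuousOn.integrableOn_compact hcomp
  -- Multiplied by `δ`, the divergence becomes a difference of two derivatives along the edges at
  -- `a`, to which the one-directional formulas `g₁` and `g₂` apply.
  have htr : δ * ∫ x in convexHull ℝ {a, b, c}, ∑ d, partialDeriv v d d x =
      (∫ x in convexHull ℝ {a, b, c}, cross (b - a) (fderiv ℝ v x (c - a))) -
        ∫ x in convexHull ℝ {a, b, c}, cross (c - a) (fderiv ℝ v x (b - a)) := by
    rw [← integral_sub (hci _ _) (hci _ _), ← integral_const_mul]
    congr 1 with x
    have := cross_mul_trace (fderiv ℝ v x) (b - a) (c - a)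
    rw [cross_swap (_ : Plane) (c - a), cross_swap (fderiv ℝ v x (b - a))] at this
    simp only [partialDeriv]
    rw [hδ, cross_swap (b - a) (c - a), this]; ring
  rw [g₁, g₂] at htr
  -- the parametrizations of the edges in opposite directions
  have rev (u x y : Plane) : ∫ t in (0 : ℝ)..1, cross u (v (x + t • (y - x))) =
      ∫ t in (0 : ℝ)..1, cross u (v (y + t • (x - y))) := by
    have := intervalIntegral.integral_comp_sub_left (a := 0) (b := 1)
      (fun t : ℝ => cross u (v (x + t • (y - x)))) 1
    simp only [sub_self, sub_zero] at this
    rw [← this]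
    refine intervalIntegral.integral_congr fun t _ => ?_
    congr 2
    module
  have lin (x y : Plane) : (∫ t in (0 : ℝ)..1, cross (c - b) (v (x + t • (y - x)))) =
      (∫ t in (0 : ℝ)..1, cross (c - a) (v (x + t • (y - x)))) -
        ∫ t in (0 : ℝ)..1, cross (b - a) (v (x + t • (y - x))) := by
    rw [← intervalIntegral.integral_sub (hsegInt _ _ _) (hsegInt _ _ _)]
    refine intervalIntegral.integral_congr fun t _ => ?_
    simp [cross]; ring
  have neg (x y : Plane) : (∫ t in (0 : ℝ)..1, cross (a - c) (v (x + t • (y - x)))) =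
      -∫ t in (0 : ℝ)..1, cross (c - a) (v (x + t • (y - x))) := by
    rw [← intervalIntegral.integral_neg]
    refine intervalIntegral.integral_congr fun t _ => ?_
    simp [cross]; ring
  rw [lin, neg, rev (c - a) c a]
  rw [rev (b - a) c b] at htr
  have habs : |δ|⁻¹ * δ * δ = |δ| := by
    rw [mul_assoc, ← abs_mul_abs_self, ← mul_assoc, inv_mul_cancel₀ (abs_ne_zero.2 h), one_mul]
  -- The orientation sign in each flux times `δ` is `|δ|`, the Jacobian factor in `htr`.
  apply mul_left_cancel₀ h
  rw [htr]
  linear_combination (-(∫ t in (0 : ℝ)..1, cross (b - a) (v (b + t • (c - b)))) +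
    (∫ t in (0 : ℝ)..1, cross (b - a) (v (a + t • (b - a)))) +
    (∫ t in (0 : ℝ)..1, cross (c - a) (v (b + t • (c - b)))) -
    (∫ t in (0 : ℝ)..1, cross (c - a) (v (a + t • (c - a))))) * habs

/-! ### Triangles of a mesh -/

lemma mem_convexHull_triple (a b c : Plane) {s t : ℝ} (hs : 0 ≤ s) (ht : 0 ≤ t) (hst : s + t ≤ 1) :
    a + (s • (b - a) + t • (c - a)) ∈ convexHull ℝ ({a, b, c} : Set Plane) := by
  rw [convexHull_triple]
  exact ⟨!₂[s, t], by simpa using ⟨hs, ht, hst⟩, by simp⟩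

/-- Two triangles with a common edge and no other common point lie on different sides of it. -/
lemma cross_mul_cross_neg {a b c d : Plane} (hc : cross (b - a) (c - a) ≠ 0)
    (hd : cross (b - a) (d - a) ≠ 0)
    (h : convexHull ℝ {a, b, c} ∩ convexHull ℝ {a, b, d} ⊆ convexHull ℝ ({a, b} : Set Plane)) :
    cross (b - a) (c - a) * cross (b - a) (d - a) < 0 := by
  by_contra hneg
  have hpos : 0 < cross (b - a) (c - a) * cross (b - a) (d - a) :=
    lt_of_le_of_ne (not_lt.1 hneg) (mul_ne_zero hc hd).symm
  set δ := cross (b - a) (c - a) with hδ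
  set δ' := cross (b - a) (d - a) with hδ'
  -- Cramer's rule for `c - a` in the basis `b - a`, `d - a`; being on the same side means `β > 0`.
  set α := cross (c - a) (d - a) / δ' with hα
  set β := δ / δ' with hβ
  have hβ0 : 0 < β := by
    rw [hβ, div_eq_mul_inv, ← div_eq_mul_inv]
    rcases mul_pos_iff.1 hpos with ⟨h1, h2⟩ | ⟨h1, h2⟩
    · exact div_pos h1 h2
    · exact div_pos_of_neg_of_neg h1 h2
  have hdec : c - a = α • (b - a) + β • (d - a) := by
    ext i
    simp only [PiLp.add_apply, PiLp.smul_apply, smul_eq_mul]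
    rw [hα, hβ]
    field_simp
    rw [hδ', hδ]
    fin_cases i <;> simp [cross] <;> ring
  have hM : 0 < 1 + 2 * |α| + 2 * β := by positivity
  -- A point at height `ε` over the middle of the edge. This `ε` satisfies `(1 - ε) / 2 = ε|α| +
  -- εβ`, just enough for its coordinates in the second triangle to be admissible as well. It is
  -- then a common point off the line `ab`.
  set ε := (1 + 2 * |α| + 2 * β)⁻¹ with hε
  have hε0 : 0 < ε := inv_pos.2 hM
  have hεM : ε + 2 * (ε * |α|) + 2 * (ε * β) = 1 := by
    have : ε * (1 + 2 * |α| + 2 * β) = 1 := inv_mul_cancel₀ hM.ne'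
    linarith
  have h1 : 0 ≤ ε * |α| := by positivity
  have h2 : 0 ≤ ε * β := by positivity
  have h3 : ε * α ≤ ε * |α| := by gcongr; exact le_abs_self α
  have h4 : -(ε * |α|) ≤ ε * α := by
    have := neg_abs_le α
    nlinarith
  have p1 := mem_convexHull_triple a b c (s := (1 - ε) / 2) (t := ε) (by linarith) hε0.le
    (by linarith)
  have p2 := mem_convexHull_triple a b d (s := (1 - ε) / 2 + ε * α) (t := ε * β) (by linarith) h2
    (by linarith)
  have e : a + (((1 - ε) / 2 + ε * α) • (b - a) + (ε * β) • (d - a)) =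
      a + (((1 - ε) / 2) • (b - a) + ε • (c - a)) := by
    rw [hdec]; module
  rw [e] at p2
  have p3 := h ⟨p1, p2⟩
  rw [convexHull_pair, segment_eq_image'] at p3
  obtain ⟨t, -, ht⟩ := p3
  have ht' : t • (b - a) = ((1 - ε) / 2) • (b - a) + ε • (c - a) := add_left_cancel ht
  have := congrArg (cross (b - a)) ht'
  rw [cross_add, cross_smul, cross_smul, cross_smul, cross_self] at this
  have : ε * δ = 0 := by linarith
  exact (mul_ne_zero hε0.ne' hc) this

open scoped Classical in
lemma ne_of_card_eq_three {a b c : Plane} (h : ({a, b, c} : Finset Plane).card = 3) :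
    a ≠ b ∧ a ≠ c ∧ b ≠ c := by
  refine ⟨?_, ?_, ?_⟩ <;> rintro rfl
  · rw [Finset.insert_eq_of_mem (by simp)] at h
    have := Finset.card_le_two (a := a) (b := c); omega
  · rw [Finset.insert_eq_of_mem (by simp)] at h
    have := Finset.card_le_two (a := b) (b := a); omega
  · rw [Finset.pair_eq_singleton] at h
    have := Finset.card_le_two (a := a) (b := b); omega

lemma cross_ne_zero_of_not_collinear {a b c : Plane} (hab : a ≠ b)
    (h : ¬Collinear ℝ {a, b, c}) : cross (b - a) (c - a) ≠ 0 := by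
  intro h0
  apply h
  rw [collinear_iff_of_mem (p₀ := a) (by simp)]
  have hn : ‖b - a‖ ^ 2 ≠ 0 := pow_ne_zero _ (norm_ne_zero_iff.2 (sub_ne_zero.2 hab.symm))
  refine ⟨b - a, fun q hq => ?_⟩
  rcases hq with rfl | rfl | rfl
  · exact ⟨0, by simp⟩
  · exact ⟨1, by simp⟩
  · refine ⟨inner ℝ (b - a) (q - a) / ‖b - a‖ ^ 2, ?_⟩
    have := norm_sq_smul_eq (b - a) (q - a)
    rw [h0, zero_smul, add_zero] at this
    rw [div_eq_inv_mul, mul_smul, ← this, inv_smul_smul₀ hn]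
    simp

open scoped Classical in
lemma cross_ne_zero_of_affineIndependent {a b c : Plane} (hne : a ≠ b ∧ a ≠ c ∧ b ≠ c)
    (h : AffineIndependent ℝ ((↑) : ({a, b, c} : Finset Plane) → Plane)) :
    cross (b - a) (c - a) ≠ 0 := by
  obtain ⟨hab, hac, hbc⟩ := hne
  refine cross_ne_zero_of_not_collinear hab ?_
  have hf := h.finrank_vectorSpan (n := 2)
    (by rw [Fintype.card_coe, Finset.card_eq_three]; exact ⟨a, b, c, hab, hac, hbc, rfl⟩)
  have hr : Set.range ((↑) : ({a, b, c} : Finset Plane) → Plane) = {a, b, c} := by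
    ext x; simp
  rw [hr] at hf
  rw [collinear_iff_finrank_le_one, hf]
  norm_num

namespace TriMesh

variable (M : TriMesh)

open scoped Classical in
lemma cross_ne_zero {T : Finset Plane} (hT : T ∈ M.triangles) {a b c : Plane}
    (h : T = {a, b, c}) : cross (b - a) (c - a) ≠ 0 := by
  subst h
  exact cross_ne_zero_of_affineIndependent (ne_of_card_eq_three (M.card_eq _ hT)) (M.indep _ hT)

open scoped Classical in
lemma exists_triple {T : Finset Plane} (hT : T ∈ M.triangles) :
    ∃ a b c, a ≠ b ∧ a ≠ c ∧ b ≠ c ∧ T = {a, b, c} ∧ cross (b - a) (c - a) ≠ 0 := by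
  obtain ⟨a, b, c, hab, hac, hbc, h⟩ := Finset.card_eq_three.1 (M.card_eq T hT)
  exact ⟨a, b, c, hab, hac, hbc, by convert h, M.cross_ne_zero hT (by convert h)⟩

open scoped Classical in
lemma exists_apex {T : Finset Plane} (hT : T ∈ M.triangles) {a b : Plane} (hab : a ≠ b)
    (h : {a, b} ⊆ T) : ∃ c, c ≠ a ∧ c ≠ b ∧ T = {a, b, c} := by
  have hcard : (T \ {a, b}).card = 1 := by
    rw [Finset.card_sdiff_of_subset h, M.card_eq T hT, Finset.card_pair hab]
  obtain ⟨c, hc⟩ := Finset.card_eq_one.1 hcard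
  have hcm : c ∈ T \ {a, b} := by rw [hc]; simp
  have hcm' := (Finset.mem_sdiff.1 hcm).2
  simp only [Finset.mem_insert, Finset.mem_singleton, not_or] at hcm'
  refine ⟨c, hcm'.1, hcm'.2, ?_⟩
  rw [← Finset.sdiff_union_of_subset h, hc]
  ext; simp only [Finset.mem_union, Finset.mem_insert, Finset.mem_singleton]; tauto

lemma exists_of_mem_edges {e : Finset Plane} (he : e ∈ M.edges) :
    ∃ T ∈ M.triangles, e ⊆ T ∧ e.card = 2 := by
  simp only [edges, Finset.mem_biUnion, Finset.mem_powersetCard] at he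
  exact he

lemma mem_edges {e T : Finset Plane} (hT : T ∈ M.triangles) (he : e ⊆ T) (hc : e.card = 2) :
    e ∈ M.edges := by
  simp only [edges, Finset.mem_biUnion, Finset.mem_powersetCard]
  exact ⟨T, hT, he, hc⟩

open scoped Classical in
/-- Two different triangles with a common edge lie on different sides of it. -/
lemma opposite {a b c d : Plane} (hT : {a, b, c} ∈ M.triangles) (hT' : {a, b, d} ∈ M.triangles)
    (hne : ({a, b, c} : Finset Plane) ≠ {a, b, d}) :
    cross (b - a) (c - a) * cross (b - a) (d - a) < 0 := by
  refine cross_mul_cross_neg (M.cross_ne_zero hT rfl) (M.cross_ne_zero hT' rfl) ?_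
  have h := M.conforming _ hT _ hT'
  have hcd : c ≠ d := by rintro rfl; exact hne rfl
  have hs : (({a, b, c} : Finset Plane) : Set Plane) ∩ (({a, b, d} : Finset Plane) : Set Plane) =
      {a, b} := by
    ext x
    simp only [Finset.coe_insert, Finset.coe_singleton, Set.mem_inter_iff, Set.mem_insert_iff,
      Set.mem_singleton_iff]
    constructor
    · rintro ⟨rfl | rfl | rfl, h2⟩
      · exact Or.inl rfl
      · exact Or.inr rfl
      · rcases h2 with h2 | h2 | h2
        · exact Or.inl h2
        · exact Or.inr h2
        · exact absurd h2 hcd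
    · rintro (rfl | rfl) <;> simp
  rw [hs] at h
  simpa using h

open scoped Classical in
/-- The fluxes through a common edge of two triangles cancel. -/
lemma triFlux_add_triFlux {T T' e : Finset Plane} (hT : T ∈ M.triangles) (hT' : T' ∈ M.triangles)
    (hne : T ≠ T') (he : e ⊆ T) (he' : e ⊆ T') (hc : e.card = 2) (v : Plane → Plane) :
    triFlux T e v + triFlux T' e v = 0 := by
  obtain ⟨a, b, hab, h⟩ := Finset.card_eq_two.1 hc
  obtain rfl : e = {a, b} := by convert h
  obtain ⟨c, -, -, rfl⟩ := M.exists_apex hT hab he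
  obtain ⟨d, -, -, rfl⟩ := M.exists_apex hT' hab he'
  have hlt := M.opposite hT hT' hne
  rw [triFlux_eq (M.cross_ne_zero hT rfl), triFlux_eq (M.cross_ne_zero hT' rfl)]
  -- Both fluxes contain the same integral from `a` to `b`, with opposite orientation signs.
  rcases mul_neg_iff.1 hlt with ⟨h1, h2⟩ | ⟨h1, h2⟩
  · rw [abs_of_pos h1, abs_of_neg h2, inv_mul_cancel₀ h1.ne', inv_neg, neg_mul (_⁻¹),
      inv_mul_cancel₀ h2.ne]
    ring
  · rw [abs_of_neg h1, abs_of_pos h2, inv_mul_cancel₀ h2.ne', inv_neg, neg_mul (_⁻¹),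
      inv_mul_cancel₀ h1.ne]
    ring

open scoped Classical in
/-- An edge belongs to at most two triangles. -/
lemma eq_or_eq_of_edge_subset {T₁ T₂ T₃ e : Finset Plane} (h₁ : T₁ ∈ M.triangles)
    (h₂ : T₂ ∈ M.triangles) (h₃ : T₃ ∈ M.triangles) (hne : T₁ ≠ T₂) (he₁ : e ⊆ T₁) (he₂ : e ⊆ T₂)
    (he₃ : e ⊆ T₃) (hc : e.card = 2) : T₃ = T₁ ∨ T₃ = T₂ := by
  obtain ⟨a, b, hab, h⟩ := Finset.card_eq_two.1 hc
  obtain rfl : e = {a, b} := by convert h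
  obtain ⟨c₁, -, -, rfl⟩ := M.exists_apex h₁ hab he₁
  obtain ⟨c₂, -, -, rfl⟩ := M.exists_apex h₂ hab he₂
  obtain ⟨c₃, -, -, rfl⟩ := M.exists_apex h₃ hab he₃
  by_contra! hn
  have l1 := M.opposite h₁ h₂ hne
  have l2 := M.opposite h₃ h₁ hn.1
  have l3 := M.opposite h₃ h₂ hn.2
  -- Three apexes cannot be pairwise on opposite sides of a line: the product of the last two
  -- inequalities is a square times the left side of the first.
  nlinarith [mul_pos_of_neg_of_neg l2 l3,
    mul_nonneg (neg_nonneg.2 l1.le) (sq_nonneg (cross (b - a) (c₃ - a)))]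

end TriMesh

/-! ### Piecewise continuous and piecewise smooth functions -/

lemma isCompact_hull (T : Finset Plane) : IsCompact (convexHull ℝ (T : Set Plane)) :=
  T.finite_toSet.isCompact_convexHull ℝ

lemma interior_hull_ae_eq (T : Finset Plane) :
    interior (convexHull ℝ (T : Set Plane)) =ᵐ[volume] convexHull ℝ (T : Set Plane) :=
  interior_ae_eq_of_null_frontier ((convex_convexHull ℝ _).addHaar_frontier volume)

lemma restrict_interior_hull (T : Finset Plane) :
    (volume : Measure Plane).restrict (interior (convexHull ℝ (T : Set Plane))) =
      volume.restrict (convexHull ℝ (T : Set Plane)) :=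
  Measure.restrict_congr_set (interior_hull_ae_eq T)

/-- The frontier of a convex set is null. This matters because `fderiv` of a piecewise field carries
no useful information on the edges. -/
lemma setIntegral_hull_congr {T : Finset Plane} {f g : Plane → ℝ}
    (h : Set.EqOn f g (interior (convexHull ℝ (T : Set Plane)))) :
    ∫ x in convexHull ℝ (T : Set Plane), f x = ∫ x in convexHull ℝ (T : Set Plane), g x := by
  rw [← restrict_interior_hull]
  exact setIntegral_congr_fun isOpen_interior.measurableSet h

namespace TriMesh

variable (M : TriMesh)

lemma affineSpan_eq_top_iff {T S : Finset Plane} (hT : T ∈ M.triangles) (hS : S ⊆ T) :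
    affineSpan ℝ (S : Set Plane) = ⊤ ↔ S.card = 3 := by
  have h : AffineIndependent ℝ ((↑) : ↥(S : Set Plane) → Plane) :=
    AffineIndependent.mono (M.indep T hT) (Finset.coe_subset.2 hS)
  have h2 := h.affineSpan_eq_top_iff_card_eq_finrank_add_one
  rw [Subtype.range_coe] at h2
  rw [h2]
  simp

lemma nonempty_interior_hull {T : Finset Plane} (hT : T ∈ M.triangles) :
    (interior (convexHull ℝ (T : Set Plane))).Nonempty := by
  rw [interior_convexHull_nonempty_iff_affineSpan_eq_top,
    M.affineSpan_eq_top_iff hT subset_rfl]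
  exact M.card_eq T hT

lemma closure_interior_hull {T : Finset Plane} (hT : T ∈ M.triangles) :
    closure (interior (convexHull ℝ (T : Set Plane))) = convexHull ℝ (T : Set Plane) := by
  rw [(convex_convexHull ℝ _).closure_interior_eq_closure_of_nonempty_interior
    (M.nonempty_interior_hull hT), (isCompact_hull T).isClosed.closure_eq]

-- By conformity the overlap lies in the affine span of the common vertices, a proper subspace
-- unless all three vertices are common.
open scoped Classical in
lemma aedisjoint_hull {T T' : Finset Plane} (hT : T ∈ M.triangles) (hT' : T' ∈ M.triangles)
    (hne : T ≠ T') :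
    AEDisjoint volume (convexHull ℝ (T : Set Plane)) (convexHull ℝ (T' : Set Plane)) := by
  have hsub := (M.conforming T hT T' hT').trans (convexHull_subset_affineSpan _)
  refine measure_mono_null hsub (Measure.addHaar_affineSubspace volume _ ?_)
  rw [← Finset.coe_inter, Ne, M.affineSpan_eq_top_iff hT Finset.inter_subset_left]
  intro h
  have h1 := Finset.eq_of_subset_of_card_le (Finset.inter_subset_left (s₁ := T) (s₂ := T'))
    (by rw [h, M.card_eq T hT])
  have h2 := Finset.eq_of_subset_of_card_le (Finset.inter_subset_right (s₁ := T) (s₂ := T'))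
    (by rw [h, M.card_eq T' hT'])
  exact hne (h1.symm.trans h2)

lemma restrict_region : (volume : Measure Plane).restrict M.region =
    ∑ T ∈ M.triangles, volume.restrict (convexHull ℝ (T : Set Plane)) := by
  have h : M.region = ⋃ T : M.triangles, convexHull ℝ (T.1 : Set Plane) := by
    rw [region, Set.iUnion_subtype]
  rw [h, Measure.restrict_iUnion_ae, Measure.sum_fintype]
  · exact Finset.sum_coe_sort M.triangles
      fun T => (volume : Measure Plane).restrict (convexHull ℝ (T : Set Plane))
  · exact fun T T' hne => M.aedisjoint_hull T.2 T'.2 fun h => hne (Subtype.ext h)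
  · exact fun T => (isCompact_hull T.1).measurableSet.nullMeasurableSet

lemma hull_subset_region {T : Finset Plane} (hT : T ∈ M.triangles) :
    convexHull ℝ (T : Set Plane) ⊆ M.region :=
  Set.subset_biUnion_of_mem (u := fun T : Finset Plane => convexHull ℝ (T : Set Plane)) hT

lemma mem_region {x : Plane} :
    x ∈ M.region ↔ ∃ T ∈ M.triangles, x ∈ convexHull ℝ (T : Set Plane) := by
  simp [region]

lemma ae_region {p : Plane → Prop}
    (h : ∀ T ∈ M.triangles, ∀ x ∈ interior (convexHull ℝ (T : Set Plane)), p x) :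
    ∀ᵐ x ∂(volume : Measure Plane).restrict M.region, p x := by
  rw [restrict_region, ae_finsetSum_measure_iff]
  intro T hT
  rw [← restrict_interior_hull]
  exact (ae_restrict_iff' isOpen_interior.measurableSet).2 (ae_of_all _ (h T hT))

end TriMesh

/-- Continuous up to the boundary in each triangle, up to values on the edges. -/
def PiecewiseContinuous (M : TriMesh) (f : Plane → ℝ) : Prop :=
  ∀ T ∈ M.triangles, ∃ g : Plane → ℝ, Continuous g ∧
    Set.EqOn f g (interior (convexHull ℝ (T : Set Plane)))

/-- Continuously differentiable up to the boundary in each triangle. -/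
def PiecewiseSmooth {E : Type*} [NormedAddCommGroup E] [NormedSpace ℝ E] (M : TriMesh)
    (f : Plane → E) : Prop :=
  ∀ T ∈ M.triangles, ∃ g : Plane → E, ContDiff ℝ 1 g ∧ Set.EqOn f g (convexHull ℝ (T : Set Plane))

variable {M : TriMesh}

namespace PiecewiseContinuous

variable {f g : Plane → ℝ}

lemma mul (hf : PiecewiseContinuous M f) (hg : PiecewiseContinuous M g) :
    PiecewiseContinuous M fun x => f x * g x := fun T hT => by
  obtain ⟨f', hf', e⟩ := hf T hT
  obtain ⟨g', hg', e'⟩ := hg T hT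
  exact ⟨_, hf'.mul hg', fun x hx => by simp [e hx, e' hx]⟩

lemma sum {ι : Type*} (s : Finset ι) {f : ι → Plane → ℝ}
    (hf : ∀ i ∈ s, PiecewiseContinuous M (f i)) :
    PiecewiseContinuous M fun x => ∑ i ∈ s, f i x := fun T hT => by
  choose! f' hf' e using fun i hi => hf i hi T hT
  exact ⟨fun x => ∑ i ∈ s, f' i x, continuous_finsetSum s hf',
    fun x hx => Finset.sum_congr rfl fun i hi => e i hi hx⟩

lemma integrableOn_hull (hf : PiecewiseContinuous M f) {T : Finset Plane} (hT : T ∈ M.triangles) :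
    IntegrableOn f (convexHull ℝ (T : Set Plane)) := by
  obtain ⟨f', hf', e⟩ := hf T hT
  have h : IntegrableOn f' (convexHull ℝ (T : Set Plane)) :=
    hf'.continuousOn.integrableOn_compact (isCompact_hull T)
  rw [IntegrableOn, ← restrict_interior_hull] at h ⊢
  exact IntegrableOn.congr_fun h e.symm isOpen_interior.measurableSet

lemma integrableOn (hf : PiecewiseContinuous M f) : IntegrableOn f M.region := by
  rw [IntegrableOn, M.restrict_region, integrable_finsetSum_measure]
  exact fun T hT => hf.integrableOn_hull hT

lemma setIntegral_region (hf : PiecewiseContinuous M f) :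
    ∫ x in M.region, f x = ∑ T ∈ M.triangles, ∫ x in convexHull ℝ (T : Set Plane), f x := by
  rw [M.restrict_region, integral_finsetSum_measure]
  exact fun T hT => hf.integrableOn_hull hT

end PiecewiseContinuous

namespace PiecewiseSmooth

variable {E : Type*} [NormedAddCommGroup E] [NormedSpace ℝ E]

lemma piecewiseContinuous {f : Plane → ℝ} (hf : PiecewiseSmooth M f) :
    PiecewiseContinuous M f := fun T hT => by
  obtain ⟨f', hf', e⟩ := hf T hT
  exact ⟨f', hf'.continuous, e.mono interior_subset⟩

lemma smul {f : Plane → ℝ} {g : Plane → E} (hf : PiecewiseSmooth M f) (hg : PiecewiseSmooth M g) :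
    PiecewiseSmooth M fun x => f x • g x := fun T hT => by
  obtain ⟨f', hf', e⟩ := hf T hT
  obtain ⟨g', hg', e'⟩ := hg T hT
  exact ⟨_, hf'.smul hg', fun x hx => by simp [e hx, e' hx]⟩

lemma differentiableAt {f : Plane → E} (hf : PiecewiseSmooth M f) {T : Finset Plane}
    (hT : T ∈ M.triangles) {x : Plane} (hx : x ∈ interior (convexHull ℝ (T : Set Plane))) :
    DifferentiableAt ℝ f x := by
  obtain ⟨f', hf', e⟩ := hf T hT
  exact ((hf'.differentiable one_ne_zero) x).congr_of_eventuallyEq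
    (Filter.eventuallyEq_of_mem (mem_interior_iff_mem_nhds.1 hx) e)

end PiecewiseSmooth

lemma fderiv_eq_of_eqOn {E : Type*} [NormedAddCommGroup E] [NormedSpace ℝ E] {T : Finset Plane}
    {f g : Plane → E} (h : Set.EqOn f g (convexHull ℝ (T : Set Plane))) {x : Plane}
    (hx : x ∈ interior (convexHull ℝ (T : Set Plane))) : fderiv ℝ f x = fderiv ℝ g x :=
  (Filter.eventuallyEq_of_mem (mem_interior_iff_mem_nhds.1 hx) h).fderiv_eq

lemma partialDeriv_eq_of_eqOn {T : Finset Plane}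
    {v w : Plane → Plane} (h : Set.EqOn v w (convexHull ℝ (T : Set Plane))) {x : Plane}
    (hx : x ∈ interior (convexHull ℝ (T : Set Plane))) (c d : Fin 2) :
    partialDeriv v c d x = partialDeriv w c d x := by
  rw [partialDeriv, partialDeriv, fderiv_eq_of_eqOn h hx]

lemma continuous_partialDeriv {v : Plane → Plane} (hv : ContDiff ℝ 1 v) (c d : Fin 2) :
    Continuous (partialDeriv v c d) := by
  have h2 : Continuous fun x => fderiv ℝ v x (EuclideanSpace.single d 1) :=
    (hv.continuous_fderiv one_ne_zero).clm_apply continuous_const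
  unfold partialDeriv
  fun_prop

lemma PiecewiseSmooth.partialDeriv {v : Plane → Plane} (hv : PiecewiseSmooth M v) (c d : Fin 2) :
    PiecewiseContinuous M (partialDeriv v c d) := fun T hT => by
  obtain ⟨w, hw, e⟩ := hv T hT
  exact ⟨_, continuous_partialDeriv hw c d, fun x hx => partialDeriv_eq_of_eqOn e hx c d⟩

/-! ### The divergence theorem on a mesh -/

lemma triFlux_congr {T e : Finset Plane} {v w : Plane → Plane}
    (h : Set.EqOn v w (convexHull ℝ (e : Set Plane))) : triFlux T e v = triFlux T e w := by
  refine setIntegral_congr_fun (isCompact_hull e).measurableSet fun x hx => ?_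
  simp only [h hx]

open scoped Classical in
lemma edgeFlux_eq (v : Plane → Plane) (e : Finset Plane) :
    M.edgeFlux v e = ∑ T ∈ M.triangles with e ⊆ T, triFlux T e v := rfl

lemma edgeFlux_eq_zero {v : Plane → Plane} {e : Finset Plane}
    (h : ∀ x ∈ convexHull ℝ (e : Set Plane), v x = 0) : M.edgeFlux v e = 0 := by
  classical
  rw [edgeFlux_eq]
  refine Finset.sum_eq_zero fun T _ => ?_
  rw [triFlux_congr (w := 0) h]
  simp [triFlux]

-- The field may be replaced by its smooth extension from the triangle: the derivatives agree in the
-- interior, and the fluxes only see values on the closed edges.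
open scoped Classical in
lemma setIntegral_hull_div {T : Finset Plane} (hT : T ∈ M.triangles) {v : Plane → Plane}
    (hv : PiecewiseSmooth M v) :
    ∫ x in convexHull ℝ (T : Set Plane), ∑ d, partialDeriv v d d x =
      ∑ e ∈ T.powersetCard 2, triFlux T e v := by
  obtain ⟨w, hw, h⟩ := hv T hT
  rw [setIntegral_hull_congr (g := fun x => ∑ d, partialDeriv w d d x)
    (fun x hx => Finset.sum_congr rfl fun d _ => partialDeriv_eq_of_eqOn h hx d d)]
  have hs : ∑ e ∈ T.powersetCard 2, triFlux T e v = ∑ e ∈ T.powersetCard 2, triFlux T e w :=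
    Finset.sum_congr rfl fun e he => triFlux_congr <| h.mono <|
      convexHull_mono (Finset.coe_subset.2 (Finset.mem_powersetCard.1 he).1)
  rw [hs]
  obtain ⟨a, b, c, hab, hac, hbc, rfl, hne⟩ := M.exists_triple hT
  rw [← setIntegral_triangle_div hne hab hac hbc hw]
  simp

-- Such an edge lies in exactly two triangles, whose outward fluxes cancel.
open scoped Classical in
lemma edgeFlux_eq_zero_of_notMem_boundaryEdges {e : Finset Plane} (he : e ∈ M.edges)
    (hb : e ∉ M.boundaryEdges) (v : Plane → Plane) : M.edgeFlux v e = 0 := by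
  obtain ⟨T, hT, heT, hc⟩ := M.exists_of_mem_edges he
  have : ∃ T' ∈ M.triangles, e ⊆ T' ∧ T ≠ T' := by
    by_contra! hn
    refine hb (Finset.mem_filter.2 ⟨he, T, ⟨hT, heT⟩, ?_⟩)
    rintro T' ⟨h1, h2⟩
    exact (hn T' h1 h2).symm
  obtain ⟨T', hT', heT', hne⟩ := this
  have hf : M.triangles.filter (fun T => e ⊆ T) = {T, T'} := by
    ext S
    simp only [Finset.mem_filter, Finset.mem_insert, Finset.mem_singleton]
    constructor
    · rintro ⟨h1, h2⟩
      exact M.eq_or_eq_of_edge_subset hT hT' h1 hne heT heT' h2 hc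
    · rintro (rfl | rfl)
      · exact ⟨hT, heT⟩
      · exact ⟨hT', heT'⟩
  rw [edgeFlux_eq]
  refine (Finset.sum_congr (by convert hf) fun _ _ => rfl).trans ?_
  rw [Finset.sum_pair hne]
  exact M.triFlux_add_triFlux hT hT' hne heT heT' hc v

lemma PiecewiseSmooth.div {v : Plane → Plane} (hv : PiecewiseSmooth M v) :
    PiecewiseContinuous M fun x => ∑ d, DDPNM.partialDeriv v d d x :=
  PiecewiseContinuous.sum _ fun d _ => hv.partialDeriv d d

/-- The divergence theorem on the region of a mesh. -/
theorem setIntegral_region_div {v : Plane → Plane} (hv : PiecewiseSmooth M v) :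
    ∫ x in M.region, ∑ d, partialDeriv v d d x = ∑ e ∈ M.boundaryEdges, M.edgeFlux v e := by
  classical
  have hsub : M.boundaryEdges ⊆ M.edges := Finset.filter_subset _ _
  rw [hv.div.setIntegral_region, Finset.sum_subset hsub
    fun e he hb => edgeFlux_eq_zero_of_notMem_boundaryEdges he hb v,
    Finset.sum_congr rfl fun T hT => setIntegral_hull_div hT hv]
  simp only [edgeFlux_eq]
  -- Interior edges were added at no cost, so both sides now sum over all incident pairs of a
  -- triangle and an edge.
  refine Finset.sum_comm' fun T e => ?_
  rw [Finset.mem_powersetCard, Finset.mem_filter]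
  constructor
  · rintro ⟨hT, he, hc⟩
    exact ⟨⟨hT, he⟩, M.mem_edges hT he hc⟩
  · rintro ⟨⟨hT, he⟩, hE⟩
    obtain ⟨_, _, _, hc⟩ := M.exists_of_mem_edges hE
    exact ⟨hT, he, hc⟩

lemma PiecewiseSmooth.of_affine {q : Plane → ℝ} {α : Finset Plane → ℝ}
    {ℓ : Finset Plane → Plane →L[ℝ] ℝ}
    (hq : ∀ T ∈ M.triangles, ∀ x ∈ convexHull ℝ (T : Set Plane), q x = α T + ℓ T x) :
    PiecewiseSmooth M q :=
  fun T hT => ⟨_, contDiff_const.add (ℓ T).contDiff, hq T hT⟩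

/-- Integration by parts against a piecewise affine function. -/
theorem setIntegral_region_mul_div {q : Plane → ℝ} {α : Finset Plane → ℝ}
    {ℓ : Finset Plane → Plane →L[ℝ] ℝ}
    (hq : ∀ T ∈ M.triangles, ∀ x ∈ convexHull ℝ (T : Set Plane), q x = α T + ℓ T x)
    {v : Plane → Plane} (hv : PiecewiseSmooth M v) :
    ∫ x in M.region, q x * ∑ d, partialDeriv v d d x =
      ∑ e ∈ M.boundaryEdges, M.edgeFlux (fun x => q x • v x) e -
        ∑ T ∈ M.triangles, ∫ x in convexHull ℝ (T : Set Plane), ℓ T (v x) := by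
  have hqs := PiecewiseSmooth.of_affine hq
  have hqv : PiecewiseSmooth M fun x => q x • v x := hqs.smul hv
  have hqd : PiecewiseContinuous M fun x => q x * ∑ d, partialDeriv v d d x :=
    hqs.piecewiseContinuous.mul hv.div
  rw [← setIntegral_region_div hqv, hqd.setIntegral_region, hqv.div.setIntegral_region,
    ← Finset.sum_sub_distrib]
  refine Finset.sum_congr rfl fun T hT => ?_
  have hl : IntegrableOn (fun x => ℓ T (v x)) (convexHull ℝ (T : Set Plane)) := by
    obtain ⟨w, hw, h⟩ := hv T hT
    refine IntegrableOn.congr_fun (f := fun x => ℓ T (w x)) ?_ (fun x hx => by simp [h hx])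
      (isCompact_hull T).measurableSet
    exact ((ℓ T).continuous.comp hw.continuous).continuousOn.integrableOn_compact (isCompact_hull T)
  rw [← integral_sub (hqv.div.integrableOn_hull hT) hl]
  refine setIntegral_hull_congr fun x hx => ?_
  have hv' := (hv.differentiableAt hT hx).hasFDerivAt
  have hq' : HasFDerivAt q (ℓ T) x :=
    ((ℓ T).hasFDerivAt.const_add (α T)).congr_of_eventuallyEq
      (Filter.eventuallyEq_of_mem (mem_interior_iff_mem_nhds.1 hx) (hq T hT))
  -- Product rule: the divergence of `q v` is `q` times the divergence of `v` plus the gradient of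
  -- `q` applied to `v`.
  have hd := (hq'.smul hv').fderiv
  have hx' : v x = ∑ d, v x d • EuclideanSpace.single d (1 : ℝ) := by
    ext i; fin_cases i <;> simp
  have hlx : ℓ T (v x) = ∑ d, v x d * ℓ T (EuclideanSpace.single d 1) := by
    conv_lhs => rw [hx', map_sum]
    simp
  simp only [partialDeriv]
  rw [show (fun x => q x • v x) = q • v from rfl, hd, hlx, Finset.mul_sum,
    ← Finset.sum_sub_distrib]
  refine Finset.sum_congr rfl fun d _ => ?_
  simp
  ring

/-! ### Lagrange functions -/

lemma contDiff_eval (P : MvPolynomial (Fin 2) ℝ) :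
    ContDiff ℝ 1 fun x : Plane => MvPolynomial.eval (fun c => x c) P := by
  induction P using MvPolynomial.induction_on with
  | C a => simpa using contDiff_const
  | add p q hp hq => simpa using hp.add hq
  | mul_X p i hp =>
    simpa using hp.mul (EuclideanSpace.proj i : Plane →L[ℝ] ℝ).contDiff

lemma piecewiseSmooth_of_mem_lagrangeSpace {k : ℕ} {f : Plane → ℝ} (hf : f ∈ lagrangeSpace M k) :
    PiecewiseSmooth M f := fun T hT => by
  obtain ⟨P, -, hP⟩ := hf.2.1 T hT
  exact ⟨_, contDiff_eval P, hP⟩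

lemma piecewiseSmooth_of_mem_velocitySpace {W : Finset (Finset Plane)} {v : Plane → Plane}
    (hv : v ∈ velocitySpace M W) : PiecewiseSmooth M v := fun T hT => by
  choose g hg h using fun c => piecewiseSmooth_of_mem_lagrangeSpace (hv.1 c) T hT
  refine ⟨fun x => WithLp.toLp 2 fun c => g c x, contDiff_euclidean.2 hg, fun x hx => ?_⟩
  ext c
  exact h c hx

lemma exists_affine_of_totalDegree_le_one {P : MvPolynomial (Fin 2) ℝ} (hP : P.totalDegree ≤ 1) :
    ∃ (α : ℝ) (ℓ : Plane →L[ℝ] ℝ), ∀ x : Plane,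
      MvPolynomial.eval (fun c => x c) P = α + ℓ x := by
  have key : ∀ d ∈ P.support, ∃ (α : ℝ) (ℓ : Plane →L[ℝ] ℝ), ∀ x : Plane,
      P.coeff d * ∏ i, (x i) ^ d i = α + ℓ x := by
    intro d hd
    have hdeg := (MvPolynomial.le_totalDegree hd).trans hP
    rw [Finsupp.sum_fintype _ _ fun _ => rfl, Fin.sum_univ_two] at hdeg
    have hcases : (d 0 = 0 ∧ d 1 = 0) ∨ (d 0 = 1 ∧ d 1 = 0) ∨ (d 0 = 0 ∧ d 1 = 1) := by omega
    simp only [Fin.prod_univ_two]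
    rcases hcases with ⟨h0, h1⟩ | ⟨h0, h1⟩ | ⟨h0, h1⟩
    · exact ⟨P.coeff d, 0, fun x => by simp [h0, h1]⟩
    · exact ⟨0, P.coeff d • EuclideanSpace.proj 0, fun x => by simp [h0, h1]⟩
    · exact ⟨0, P.coeff d • EuclideanSpace.proj 1, fun x => by simp [h0, h1]⟩
  choose! α ℓ h using key
  refine ⟨∑ d ∈ P.support, α d, ∑ d ∈ P.support, ℓ d, fun x => ?_⟩
  rw [MvPolynomial.eval_eq', Finset.sum_congr rfl fun d hd => h d hd x, Finset.sum_add_distrib]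
  simp

lemma exists_affine_of_mem_pressureSpace {q : Plane → ℝ} (hq : q ∈ pressureSpace M) :
    ∃ (α : Finset Plane → ℝ) (ℓ : Finset Plane → Plane →L[ℝ] ℝ),
      ∀ T ∈ M.triangles, ∀ x ∈ convexHull ℝ (T : Set Plane), q x = α T + ℓ T x := by
  have h : ∀ T ∈ M.triangles, ∃ (α : ℝ) (ℓ : Plane →L[ℝ] ℝ),
      ∀ x ∈ convexHull ℝ (T : Set Plane), q x = α + ℓ x := fun T hT => by
    obtain ⟨P, hP, hqP⟩ := hq.2.1 T hT
    obtain ⟨α, ℓ, h⟩ := exists_affine_of_totalDegree_le_one hP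
    exact ⟨α, ℓ, fun x hx => (hqP x hx).trans (h x)⟩
  choose! α ℓ h using h
  exact ⟨α, ℓ, h⟩

lemma exists_polynomial_eq_affine (α : ℝ) (ℓ : Plane →L[ℝ] ℝ) :
    ∃ P : MvPolynomial (Fin 2) ℝ, P.totalDegree ≤ 1 ∧
      ∀ x : Plane, α + ℓ x = MvPolynomial.eval (fun c => x c) P := by
  have hX (r : ℝ) (i : Fin 2) : (MvPolynomial.C r * MvPolynomial.X i).totalDegree ≤ 1 := by
    refine (MvPolynomial.totalDegree_mul _ _).trans ?_
    simp
  refine ⟨MvPolynomial.C α +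
    (MvPolynomial.C (ℓ (EuclideanSpace.single 0 1)) * MvPolynomial.X 0 +
      MvPolynomial.C (ℓ (EuclideanSpace.single 1 1)) * MvPolynomial.X 1), ?_, fun x => ?_⟩
  · refine (MvPolynomial.totalDegree_add _ _).trans (max_le (by simp) ?_)
    exact (MvPolynomial.totalDegree_add _ _).trans (max_le (hX _ _) (hX _ _))
  · have hx : x = x 0 • EuclideanSpace.single 0 (1 : ℝ) + x 1 • EuclideanSpace.single 1 (1 : ℝ) := by
      ext i; fin_cases i <;> simp
    conv_lhs => rw [hx, map_add, map_smul, map_smul]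
    simp [mul_comm]

lemma mul_mem_lagrangeSpace {k l : ℕ} {f g : Plane → ℝ} (hf : f ∈ lagrangeSpace M k)
    (hg : g ∈ lagrangeSpace M l) : (fun x => f x * g x) ∈ lagrangeSpace M (k + l) := by
  refine ⟨hf.1.mul hg.1, fun T hT => ?_, fun x hx => by simp [hf.2.2 x hx]⟩
  obtain ⟨P, hP, hfP⟩ := hf.2.1 T hT
  obtain ⟨R, hR, hgR⟩ := hg.2.1 T hT
  exact ⟨P * R, (MvPolynomial.totalDegree_mul P R).trans (add_le_add hP hR),
    fun x hx => by simp [hfP x hx, hgR x hx]⟩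

/-- The set where two affine functions agree is a level set of a linear functional, hence convex. -/
lemma affine_eqOn_convexHull {α α' : ℝ} {ℓ ℓ' : Plane →L[ℝ] ℝ} {S : Set Plane}
    (h : ∀ x ∈ S, α + ℓ x = α' + ℓ' x) : ∀ x ∈ convexHull ℝ S, α + ℓ x = α' + ℓ' x := by
  have hc : Convex ℝ {x | (ℓ - ℓ') x = α' - α} := convex_hyperplane (ℓ - ℓ').isLinear _
  intro x hx
  have : (ℓ - ℓ') x = α' - α := convexHull_min (fun y hy => by
    change (ℓ - ℓ') y = α' - α
    have := h y hy
    simp only [_root_.sub_apply]; linarith) hc hx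
  simp only [_root_.sub_apply] at this
  linarith

lemma exists_affine_interpolation {T : Finset Plane} (hT : T ∈ M.triangles) (w : Plane → ℝ) :
    ∃ (α : ℝ) (ℓ : Plane →L[ℝ] ℝ), ∀ y ∈ T, α + ℓ y = w y := by
  classical
  obtain ⟨a, b, c, -, -, -, rfl, hne⟩ := M.exists_triple hT
  let C (u : Plane) : Plane →L[ℝ] ℝ := u 0 • EuclideanSpace.proj 1 - u 1 • EuclideanSpace.proj 0
  have hC (u x : Plane) : C u x = cross u x := by simp [C, cross]
  -- Cramer's rule for the gradient with prescribed increments along the two edges at `a`.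
  let ℓ : Plane →L[ℝ] ℝ := (cross (b - a) (c - a))⁻¹ •
    ((w c - w a) • C (b - a) - (w b - w a) • C (c - a))
  have hℓ (x : Plane) : ℓ x = (cross (b - a) (c - a))⁻¹ *
      ((w c - w a) * cross (b - a) x - (w b - w a) * cross (c - a) x) := by
    simp [ℓ, hC]
  refine ⟨w a - ℓ a, ℓ, fun y hy => ?_⟩
  have hsub : ℓ y - ℓ a = ℓ (y - a) := (map_sub ℓ y a).symm
  have hval : ℓ (y - a) = w y - w a := by
    rw [hℓ]
    simp only [Finset.mem_insert, Finset.mem_singleton] at hy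
    rcases hy with rfl | rfl | rfl
    · simp [cross]
    · rw [cross_self, cross_swap (c - a)]; field_simp; ring
    · rw [cross_self]; field_simp; ring
  linarith

/-- The piecewise affine interpolation of given values at the vertices. -/
lemma exists_mem_lagrangeSpace (M : TriMesh) (w : Plane → ℝ) :
    ∃ f ∈ lagrangeSpace M 1, ∀ T ∈ M.triangles, ∀ y ∈ T, f y = w y := by
  classical
  choose! α ℓ h using fun (T : Finset Plane) (hT : T ∈ M.triangles) =>
    exists_affine_interpolation hT w
  let f : Plane → ℝ := fun x =>
    if hx : ∃ T ∈ M.triangles, x ∈ convexHull ℝ (T : Set Plane) then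
      α hx.choose + ℓ hx.choose x else 0
  have hf : ∀ T ∈ M.triangles, ∀ x ∈ convexHull ℝ (T : Set Plane), f x = α T + ℓ T x := by
    intro T hT x hx
    have hex : ∃ T ∈ M.triangles, x ∈ convexHull ℝ (T : Set Plane) := ⟨T, hT, hx⟩
    obtain ⟨h1, h2⟩ := hex.choose_spec
    simp only [f, dif_pos hex]
    -- The choice of triangle does not matter: two local interpolants agree at the common vertices,
    -- hence on their convex hull, which contains the overlap by conformity.
    refine affine_eqOn_convexHull (fun y hy => ?_) x (M.conforming _ h1 _ hT ⟨h2, hx⟩)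
    rw [h _ h1 y hy.1, h T hT y hy.2]
  refine ⟨f, ⟨?_, fun T hT => ?_, fun x hx => ?_⟩, fun T hT y hy => ?_⟩
  · have hr : M.region = ⋃ T : M.triangles, convexHull ℝ (T.1 : Set Plane) := by
      rw [TriMesh.region, Set.iUnion_subtype]
    rw [hr]
    -- Continuity on finitely many closed triangles glues.
    refine (locallyFinite_of_finite _).continuousOn_iUnion
      (fun T => (isCompact_hull T.1).isClosed) fun T => ?_
    exact ((continuous_const.add (ℓ T.1).continuous).continuousOn).congr (hf T.1 T.2)
  · obtain ⟨P, hP, hP'⟩ := exists_polynomial_eq_affine (α T) (ℓ T)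
    exact ⟨P, hP, fun x hx => (hf T hT x hx).trans (hP' x)⟩
  · rw [M.mem_region] at hx
    simp only [f, dif_neg hx]
  · rw [hf T hT y (subset_convexHull ℝ _ hy), h T hT y hy]

/-! ### Edge bubbles -/

lemma eq_zero_on_convexHull {f : Plane → ℝ} (hf : f ∈ lagrangeSpace M 1) {T : Finset Plane}
    (hT : T ∈ M.triangles) {S : Finset Plane} (hS : S ⊆ T) (h : ∀ y ∈ S, f y = 0) :
    ∀ x ∈ convexHull ℝ (S : Set Plane), f x = 0 := by
  obtain ⟨α, ℓ, hq⟩ := exists_affine_of_mem_pressureSpace (M := M) hf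
  have hsub : (S : Set Plane) ⊆ T := Finset.coe_subset.2 hS
  intro x hx
  rw [hq T hT x (convexHull_mono hsub hx), ← zero_add (0 : ℝ)]
  refine affine_eqOn_convexHull (α' := 0) (ℓ' := 0) (fun y hy => ?_) x hx
  rw [← hq T hT y (subset_convexHull ℝ _ (hsub hy)), h y hy]
  simp

lemma integral_bubble_reference (t : ℝ) :
    ∫ s in (0 : ℝ)..(1 - t), (1 - s - t) * s = (1 - t) ^ 3 / 6 := by
  have : (fun s : ℝ => (1 - s - t) * s) = fun s => (1 - t) * s - s ^ 2 := by ext; ring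
  rw [this, intervalIntegral.integral_sub, intervalIntegral.integral_const_mul, integral_id,
    integral_pow]
  · norm_num; ring
  · exact (by fun_prop : Continuous fun s : ℝ => (1 - t) * s).intervalIntegrable _ _
  · exact (by fun_prop : Continuous fun s : ℝ => s ^ 2).intervalIntegrable _ _

lemma integral_one_sub_pow_three : ∫ t in (0 : ℝ)..1, (1 - t) ^ 3 / 6 = 1 / 24 := by
  rw [intervalIntegral.integral_div,
    intervalIntegral.integral_comp_sub_left (fun t : ℝ => t ^ 3) 1, integral_pow]
  norm_num

open scoped Classical in
/-- The quadratic bubble function of an edge. -/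
lemma exists_bubble (M : TriMesh) {a b : Plane} (hab : a ≠ b) :
    ∃ β ∈ lagrangeSpace M 2,
      (∀ T ∈ M.triangles, ∀ S ⊆ T, ¬({a, b} ⊆ S) → ∀ x ∈ convexHull ℝ (S : Set Plane), β x = 0) ∧
      (∀ T ∈ M.triangles, {a, b} ⊆ T → 0 < ∫ x in convexHull ℝ (T : Set Plane), β x) ∧
      (∀ T ∈ M.triangles, {a, b} ⊆ T → ∀ t ∈ Set.Icc (0 : ℝ) 1,
        β (a + t • (b - a)) = (1 - t) * t) := by
  -- The bubble is the product of the two hat functions at the endpoints of the edge. On a triangle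
  -- with this edge they are the barycentric coordinates `1 - s - t` and `s`, and the integral is
  -- `|cross (b - a) (c - a)| / 24`.
  obtain ⟨f, hf, hfv⟩ := exists_mem_lagrangeSpace M fun y => if y = a then 1 else 0
  obtain ⟨g, hg, hgv⟩ := exists_mem_lagrangeSpace M fun y => if y = b then 1 else 0
  obtain ⟨α, ℓ, hα⟩ := exists_affine_of_mem_pressureSpace (M := M) hf
  obtain ⟨α', ℓ', hα'⟩ := exists_affine_of_mem_pressureSpace (M := M) hg
  have coords : ∀ c, c ≠ a → c ≠ b → {a, b, c} ∈ M.triangles → ∀ s t : ℝ,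
      α {a, b, c} + ℓ {a, b, c} (a + (s • (b - a) + t • (c - a))) = 1 - s - t ∧
      α' {a, b, c} + ℓ' {a, b, c} (a + (s • (b - a) + t • (c - a))) = s := by
    intro c hca hcb hT s t
    have v (x : Plane) (hx : x ∈ ({a, b, c} : Finset Plane)) :
        α {a, b, c} + ℓ {a, b, c} x = (if x = a then 1 else 0) ∧
        α' {a, b, c} + ℓ' {a, b, c} x = (if x = b then 1 else 0) := by
      have hx' := subset_convexHull ℝ (({a, b, c} : Finset Plane) : Set Plane) hx
      exact ⟨by rw [← hα _ hT x hx', hfv _ hT x hx], by rw [← hα' _ hT x hx', hgv _ hT x hx]⟩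
    obtain ⟨a1, a2⟩ := v a (by simp)
    obtain ⟨b1, b2⟩ := v b (by simp)
    obtain ⟨c1, c2⟩ := v c (by simp)
    simp only [if_true, if_neg hab, if_neg hab.symm, if_neg hca, if_neg hcb] at a1 a2 b1 b2 c1 c2
    simp only [map_add, map_smul, map_sub, smul_eq_mul]
    constructor
    · linear_combination (1 - s - t) * a1 + s * b1 + t * c1
    · linear_combination (1 - s - t) * a2 + s * b2 + t * c2
  refine ⟨_, mul_mem_lagrangeSpace hf hg, ?_, ?_, ?_⟩
  · intro T hT S hS hn x hx
    have : a ∉ S ∨ b ∉ S := by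
      by_contra! hm
      exact hn (by intro y hy; simp only [Finset.mem_insert, Finset.mem_singleton] at hy
                   rcases hy with rfl | rfl
                   exacts [hm.1, hm.2])
    rcases this with h | h
    · rw [eq_zero_on_convexHull hf hT hS (fun y hy => ?_) x hx, zero_mul]
      rw [hfv T hT y (hS hy), if_neg]
      rintro rfl; exact h hy
    · rw [eq_zero_on_convexHull hg hT hS (fun y hy => ?_) x hx, mul_zero]
      rw [hgv T hT y (hS hy), if_neg]
      rintro rfl; exact h hy
  · intro T hT hs
    obtain ⟨c, hca, hcb, rfl⟩ := M.exists_apex hT hab hs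
    have hne := M.cross_ne_zero hT rfl
    have heq : ∫ x in convexHull ℝ (({a, b, c} : Finset Plane) : Set Plane), f x * g x =
        ∫ x in convexHull ℝ (({a, b, c} : Finset Plane) : Set Plane),
          (α {a, b, c} + ℓ {a, b, c} x) * (α' {a, b, c} + ℓ' {a, b, c} x) :=
      setIntegral_hull_congr fun x hx => by
        simp only [hα _ hT x (interior_subset hx), hα' _ hT x (interior_subset hx)]
    rw [heq]
    have hset : (({a, b, c} : Finset Plane) : Set Plane) = {a, b, c} := by simp
    rw [hset, setIntegral_triangle a b c hne]
    simp only [(coords c hca hcb hT _ _).1, (coords c hca hcb hT _ _).2]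
    rw [setIntegral_refTriangle (f := fun x => (1 - x.1 - x.2) * x.1) (by fun_prop)]
    simp only [integral_bubble_reference]
    rw [integral_one_sub_pow_three]
    have := abs_pos.2 hne
    positivity
  · intro T hT hs t ht
    obtain ⟨c, hca, hcb, rfl⟩ := M.exists_apex hT hab hs
    have hm := mem_convexHull_triple a b c (s := t) (t := 0) ht.1 le_rfl (by linarith [ht.2])
    have hset : (({a, b, c} : Finset Plane) : Set Plane) = {a, b, c} := by simp
    rw [← hset] at hm
    have h1 := (coords c hca hcb hT t 0).1
    have h2 := (coords c hca hcb hT t 0).2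
    rw [← hα _ hT _ hm] at h1
    rw [← hα' _ hT _ hm] at h2
    simp only [zero_smul, add_zero] at h1 h2
    simp only [h1, h2, sub_zero]

lemma smul_mem_velocitySpace {W : Finset (Finset Plane)} {β : Plane → ℝ}
    (hβ : β ∈ lagrangeSpace M 2) (h : ∀ e ∈ W, ∀ x ∈ convexHull ℝ (e : Set Plane), β x = 0)
    (d : Plane) : (fun x => β x • d) ∈ velocitySpace M W := by
  refine ⟨fun c => ?_, fun e he x hx => by simp [h e he x hx]⟩
  have := (lagrangeSpace M 2).smul_mem (d c) hβ
  convert this using 1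
  ext x
  simp [mul_comm]

lemma velocitySpace_mono {W W' : Finset (Finset Plane)} (h : W ⊆ W') :
    velocitySpace M W' ≤ velocitySpace M W :=
  fun _ hv => ⟨hv.1, fun e he => hv.2 e (h he)⟩

lemma not_subset_of_edges_ne {e e' : Finset Plane} (he : e ∈ M.edges) (he' : e' ∈ M.edges)
    (hne : e' ≠ e) : ¬e ⊆ e' := by
  obtain ⟨_, _, _, hc⟩ := M.exists_of_mem_edges he
  obtain ⟨_, _, _, hc'⟩ := M.exists_of_mem_edges he'
  exact fun h => hne (Finset.eq_of_subset_of_card_le h (by rw [hc, hc'])).symm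

/-- There is a velocity whose flux through a given boundary edge does not vanish, and which
vanishes on all other boundary edges. -/
lemma exists_edgeFlux_ne_zero {e : Finset Plane} (he : e ∈ M.boundaryEdges) :
    ∃ v : Plane → Plane, (∀ W ⊆ M.boundaryEdges, e ∉ W → v ∈ velocitySpace M W) ∧
      (∀ e' ∈ M.boundaryEdges, e' ≠ e → ∀ x ∈ convexHull ℝ (e' : Set Plane), v x = 0) ∧
      M.edgeFlux v e ≠ 0 := by
  classical
  have hb := Finset.mem_filter.1 he
  obtain ⟨T, ⟨hT, heT⟩, huniq⟩ := hb.2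
  obtain ⟨_, _, _, hc⟩ := M.exists_of_mem_edges hb.1
  obtain ⟨a, b, hab, h⟩ := Finset.card_eq_two.1 hc
  obtain rfl : e = {a, b} := by convert h
  obtain ⟨β, hβ, hβ0, -, hβe⟩ := exists_bubble M hab
  have hzero : ∀ e' ∈ M.boundaryEdges, e' ≠ {a, b} →
      ∀ x ∈ convexHull ℝ (e' : Set Plane), β x = 0 := by
    intro e' he' hne
    have hE := (Finset.mem_filter.1 he').1
    obtain ⟨T', hT', heT', -⟩ := M.exists_of_mem_edges hE
    exact hβ0 T' hT' e' heT' (not_subset_of_edges_ne hb.1 hE hne)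
  -- The bubble points along the normal of the edge, so its flux is `‖b - a‖ ^ 2 / 6` up to sign.
  refine ⟨fun x => β x • rot (b - a), fun W hW hWe => smul_mem_velocitySpace hβ
    (fun e' he' => hzero e' (hW he') fun h => hWe (h ▸ he')) _,
    fun e' he' hne x hx => by simp [hzero e' he' hne x hx], ?_⟩
  obtain ⟨c, hca, hcb, rfl⟩ := M.exists_apex hT hab heT
  have hne := M.cross_ne_zero hT rfl
  have hf : M.triangles.filter (fun T => {a, b} ⊆ T) = {{a, b, c}} := by
    ext S
    simp only [Finset.mem_filter, Finset.mem_singleton]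
    constructor
    · rintro ⟨h1, h2⟩; exact huniq S ⟨h1, h2⟩
    · rintro rfl; exact ⟨hT, heT⟩
  have hflux : M.edgeFlux (fun x => β x • rot (b - a)) {a, b} =
      triFlux {a, b, c} {a, b} fun x => β x • rot (b - a) := by
    rw [edgeFlux_eq]
    refine (Finset.sum_congr (by convert hf) fun _ _ => rfl).trans ?_
    rw [Finset.sum_singleton]
  rw [hflux, triFlux_eq hne]
  have hsegInt : ∫ t in (0 : ℝ)..1, cross (b - a) (β (a + t • (b - a)) • rot (b - a)) =
      ‖b - a‖ ^ 2 / 6 := by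
    have h1 : ∫ t in (0 : ℝ)..1, cross (b - a) (β (a + t • (b - a)) • rot (b - a)) =
        ∫ t in (0 : ℝ)..1, ((1 - t - 0) * t) * ‖b - a‖ ^ 2 := by
      refine intervalIntegral.integral_congr fun t ht => ?_
      rw [Set.uIcc_of_le zero_le_one] at ht
      simp only [cross_smul, cross_rot_self, hβe _ hT heT t ht, sub_zero]
    have h2 := integral_bubble_reference 0
    simp only [sub_zero] at h1 h2
    rw [h1, intervalIntegral.integral_mul_const, h2]
    ring
  rw [hsegInt]
  have hn : ‖b - a‖ ≠ 0 := norm_ne_zero_iff.2 (sub_ne_zero.2 hab.symm)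
  exact mul_ne_zero (neg_ne_zero.2 (mul_ne_zero (inv_ne_zero (abs_ne_zero.2 hne)) hne))
    (by positivity)

/-! ### Injectivity of the discrete gradient -/

/-- A nonempty set of triangles other than all triangles has a neighbour. -/
lemma TriMesh.EdgeConnected.exists_adjacent (h : M.EdgeConnected) {P : Finset Plane → Prop}
    {S T : Finset Plane} (hS : S ∈ M.triangles) (hT : T ∈ M.triangles) (hPS : P S) (hPT : ¬P T) :
    ∃ A ∈ M.triangles, ∃ B ∈ M.triangles, P A ∧ ¬P B ∧ ∃ e ∈ M.edges, e ⊆ A ∧ e ⊆ B := by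
  by_contra! hn
  have key : ∀ B, Relation.ReflTransGen
      (fun A B : Finset Plane => B ∈ M.triangles ∧ ∃ e ∈ M.edges, e ⊆ A ∧ e ⊆ B) S B →
      B ∈ M.triangles ∧ P B := by
    intro B hB
    induction hB with
    | refl => exact ⟨hS, hPS⟩
    | tail _ hstep ih =>
      obtain ⟨hB, e, he, heA, heB⟩ := hstep
      refine ⟨hB, ?_⟩
      by_contra hPB
      exact hn _ ih.1 _ hB ih.2 hPB e he heA heB
  exact hPT (key T (h S hS T hT)).2

/-- Triangles sharing an edge share a vertex, where both constants are the value of `f`. -/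
lemma TriMesh.EdgeConnected.eq_of_piecewise_const (h : M.EdgeConnected) {E : Type*} {f : Plane → E}
    {κ : Finset Plane → E}
    (hf : ∀ T ∈ M.triangles, ∀ x ∈ convexHull ℝ (T : Set Plane), f x = κ T)
    {S T : Finset Plane} (hS : S ∈ M.triangles) (hT : T ∈ M.triangles) : κ S = κ T := by
  by_contra hne
  obtain ⟨A, hA, B, hB, hAS, hBS, e, he, heA, heB⟩ :=
    h.exists_adjacent (P := fun X => κ S = κ X) hS hT rfl hne
  obtain ⟨_, _, _, hc⟩ := M.exists_of_mem_edges he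
  obtain ⟨y, hy⟩ := Finset.card_pos.1 (by omega : 0 < e.card)
  have h1 := hf A hA y (subset_convexHull ℝ _ (heA hy))
  have h2 := hf B hB y (subset_convexHull ℝ _ (heB hy))
  exact hBS (hAS.trans (h1.symm.trans h2))

lemma TriMesh.notMem_boundaryEdges {A B e : Finset Plane} (hA : A ∈ M.triangles)
    (hB : B ∈ M.triangles) (hne : A ≠ B) (heA : e ⊆ A) (heB : e ⊆ B) : e ∉ M.boundaryEdges := by
  classical
  intro he
  obtain ⟨T, -, h⟩ := (Finset.mem_filter.1 he).2
  exact hne ((h A ⟨hA, heA⟩).trans (h B ⟨hB, heB⟩).symm)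

lemma eq_zero_of_cross_ne_zero {ℓ : Plane →L[ℝ] ℝ} {u w : Plane} (h : cross u w ≠ 0)
    (hu : ℓ u = 0) (hw : ℓ w = 0) : ℓ = 0 := by
  ext x
  have hx : cross u w • x = cross x w • u + cross u x • w := by
    ext i; fin_cases i <;> simp [cross] <;> ring
  have := congrArg ℓ hx
  simp only [map_add, map_smul, hu, hw, smul_zero, add_zero] at this
  simpa using (smul_eq_zero.1 this).resolve_left h

/-- A piecewise affine function which is orthogonal to the divergences of all discrete velocities
that vanish on the boundary has zero average gradient along each interior edge. -/
lemma exists_weights {q : Plane → ℝ} {α : Finset Plane → ℝ} {ℓ : Finset Plane → Plane →L[ℝ] ℝ}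
    (hα : ∀ T ∈ M.triangles, ∀ x ∈ convexHull ℝ (T : Set Plane), q x = α T + ℓ T x)
    (hq : ∀ v ∈ velocitySpace M M.boundaryEdges, formB M v q = 0)
    {e : Finset Plane} (he : e ∈ M.edges) (hb : e ∉ M.boundaryEdges) :
    ∃ I : Finset Plane → ℝ, (∀ T ∈ M.triangles, e ⊆ T → 0 < I T) ∧
      (∀ T ∈ M.triangles, ¬e ⊆ T → I T = 0) ∧
      ∀ d, ∑ T ∈ M.triangles, ℓ T d * I T = 0 := by
  classical
  obtain ⟨_, _, _, hc⟩ := M.exists_of_mem_edges he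
  obtain ⟨a, b, hab, h⟩ := Finset.card_eq_two.1 hc
  obtain rfl : e = {a, b} := by convert h
  obtain ⟨β, hβ, hβ0, hβI, -⟩ := exists_bubble M hab
  have hzero : ∀ e' ∈ M.boundaryEdges, ∀ x ∈ convexHull ℝ (e' : Set Plane), β x = 0 := by
    intro e' he'
    have hE := (Finset.mem_filter.1 he').1
    obtain ⟨T', hT', heT', -⟩ := M.exists_of_mem_edges hE
    exact hβ0 T' hT' e' heT' (not_subset_of_edges_ne he hE fun h => hb (h ▸ he'))
  refine ⟨fun T => ∫ x in convexHull ℝ (T : Set Plane), β x, hβI, fun T hT hn => ?_, fun d => ?_⟩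
  · refine (setIntegral_congr_fun (isCompact_hull T).measurableSet
      (hβ0 T hT T subset_rfl hn)).trans ?_
    simp
  -- Test with the bubble times the constant vector `d`. Integration by parts has no boundary term,
  -- so only the gradients weighted by the bubble integrals remain.
  · have hv := smul_mem_velocitySpace (W := M.boundaryEdges) hβ hzero d
    have h0 := hq _ hv
    rw [formB, setIntegral_region_mul_div hα (piecewiseSmooth_of_mem_velocitySpace hv),
      Finset.sum_eq_zero fun e' he' => edgeFlux_eq_zero fun x hx => by simp [hzero e' he' x hx],
      zero_sub, neg_neg] at h0
    rw [← h0]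
    refine Finset.sum_congr rfl fun T _ => ?_
    rw [← integral_const_mul]
    congr 1 with x
    simp [mul_comm]

/-- The Taylor-Hood element is stable on a connected mesh of at least three triangles: a pressure
which is orthogonal to the divergences of all discrete velocities that vanish on the boundary is
constant. -/
theorem exists_const_of_formB_eq_zero (hconn : M.EdgeConnected) (hcard : 3 ≤ M.triangles.card)
    {q : Plane → ℝ} (hqs : q ∈ pressureSpace M)
    (hq : ∀ v ∈ velocitySpace M M.boundaryEdges, formB M v q = 0) :
    ∃ c, ∀ x ∈ M.region, q x = c := by
  classical
  obtain ⟨α, ℓ, hα⟩ := exists_affine_of_mem_pressureSpace hqs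
  have hvert : ∀ T ∈ M.triangles, ∀ x ∈ T, q x = α T + ℓ T x :=
    fun T hT x hx => hα T hT x (subset_convexHull ℝ _ hx)
  have hdiff : ∀ T ∈ M.triangles, ∀ x ∈ T, ∀ y ∈ T, ℓ T (y - x) = q y - q x := by
    intro T hT x hx y hy
    rw [hvert T hT x hx, hvert T hT y hy, map_sub]; ring
  -- Along an interior edge, the gradients on both of its triangles give the same increment `q y - q
  -- x`, so the weighted sum is this increment times a positive number.
  have hedge : ∀ e ∈ M.edges, e ∉ M.boundaryEdges → ∀ x ∈ e, ∀ y ∈ e, q x = q y := by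
    intro e he hb x hx y hy
    obtain ⟨T₀, hT₀, heT₀, -⟩ := M.exists_of_mem_edges he
    obtain ⟨I, hI, hI0, hsum⟩ := exists_weights hα hq he hb
    have h1 : ∑ T ∈ M.triangles, ℓ T (y - x) * I T = (q y - q x) * ∑ T ∈ M.triangles, I T := by
      rw [Finset.mul_sum]
      refine Finset.sum_congr rfl fun T hT => ?_
      by_cases heT : e ⊆ T
      · rw [hdiff T hT x (heT hx) y (heT hy)]
      · rw [hI0 T hT heT, mul_zero, mul_zero]
    have hpos : 0 < ∑ T ∈ M.triangles, I T := by
      refine Finset.sum_pos' (fun T hT => ?_) ⟨T₀, hT₀, hI T₀ hT₀ heT₀⟩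
      by_cases heT : e ⊆ T
      · exact (hI T hT heT).le
      · rw [hI0 T hT heT]
    rw [hsum] at h1
    have := (mul_eq_zero.1 h1.symm).resolve_right hpos.ne'
    linarith
  -- Two interior edges of a triangle connect all its vertices, so `q` takes equal values there.
  have htwo : ∀ T ∈ M.triangles, ∀ e ∈ M.edges, ∀ e' ∈ M.edges, e ∉ M.boundaryEdges →
      e' ∉ M.boundaryEdges → e ≠ e' → e ⊆ T → e' ⊆ T → ℓ T = 0 := by
    intro T hT e he e' he' hb hb' hne heT heT'
    obtain ⟨_, _, _, hc⟩ := M.exists_of_mem_edges he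
    obtain ⟨_, _, _, hc'⟩ := M.exists_of_mem_edges he'
    obtain ⟨a, b, hab, h⟩ := Finset.card_eq_two.1 hc
    obtain rfl : e = {a, b} := by convert h
    obtain ⟨c, hca, hcb, rfl⟩ := M.exists_apex hT hab heT
    have hab' : q a = q b := hedge _ he hb a (by simp) b (by simp)
    have hc1 : c ∈ e' := by
      by_contra hce
      apply hne
      refine (Finset.eq_of_subset_of_card_le (fun y hy => ?_) (by rw [hc, hc'])).symm
      have := heT' hy
      simp only [Finset.mem_insert, Finset.mem_singleton] at this ⊢
      rcases this with rfl | rfl | rfl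
      · exact Or.inl rfl
      · exact Or.inr rfl
      · exact absurd hy hce
    obtain ⟨z, hz, hzc⟩ := Finset.exists_mem_ne (by omega : 1 < e'.card) c
    have hzc' : q c = q z := hedge _ he' hb' c hc1 z hz
    have hca' : q c = q a := by
      have := heT' hz
      simp only [Finset.mem_insert, Finset.mem_singleton] at this
      rcases this with rfl | rfl | rfl
      · exact hzc'
      · exact hzc'.trans hab'.symm
      · exact absurd rfl hzc
    refine eq_zero_of_cross_ne_zero (M.cross_ne_zero hT rfl) ?_ ?_
    · rw [hdiff _ hT a (by simp) b (by simp), hab', sub_self]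
    · rw [hdiff _ hT a (by simp) c (by simp), hca', sub_self]
  have hgrad : ∀ T ∈ M.triangles, ℓ T = 0 := by
    intro T hT
    obtain ⟨S, hS, hST⟩ := Finset.exists_mem_ne (by omega : 1 < M.triangles.card) T
    obtain ⟨A, hA, T', hT', rfl, hTT', e, he, heT, heT'⟩ :=
      hconn.exists_adjacent (P := fun X => X = T) hT hS rfl hST
    have hb := TriMesh.notMem_boundaryEdges hA hT' (Ne.symm hTT') heT heT'
    obtain ⟨_, _, _, hc⟩ := M.exists_of_mem_edges he
    -- A third triangle makes the pair `A`, `T'` have a further neighbour, so one of the two has two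
    -- interior edges and zero gradient. If that one is `T'`, the weighted balance across `e`, in
    -- every direction `d`, forces the gradient on `A` to vanish too.
    have hthird : ∃ R ∈ M.triangles, R ∉ ({A, T'} : Finset (Finset Plane)) := by
      by_contra! hn
      have := (Finset.card_le_card (show M.triangles ⊆ {A, T'} from hn)).trans Finset.card_le_two
      omega
    obtain ⟨R, hR, hRn⟩ := hthird
    obtain ⟨B, hB, C, hC, hBm, hCm, e', he', heB, heC⟩ :=
      hconn.exists_adjacent (P := fun X => X ∈ ({A, T'} : Finset (Finset Plane))) hA hR
        (by simp) hRn
    have hBC : B ≠ C := fun h => hCm (h ▸ hBm)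
    have hb' := TriMesh.notMem_boundaryEdges hB hC hBC heB heC
    have hee' : e ≠ e' := by
      rintro rfl
      apply hCm
      simpa using M.eq_or_eq_of_edge_subset hA hT' hC (Ne.symm hTT') heT heT' heC hc
    simp only [Finset.mem_insert, Finset.mem_singleton] at hBm
    rcases hBm with rfl | rfl
    · exact htwo B hB e he e' he' hb hb' hee' heT heB
    · have h0 : ℓ B = 0 := htwo B hB e he e' he' hb hb' hee' heT' heB
      obtain ⟨I, hI, hI0, hsum⟩ := exists_weights hα hq he hb
      ext d
      have h1 := hsum d
      rw [Finset.sum_eq_single A] at h1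
      · simpa using (mul_eq_zero.1 h1).resolve_right (hI A hA heT).ne'
      · intro X hX hXA
        by_cases heX : e ⊆ X
        · have := (M.eq_or_eq_of_edge_subset hA hT' hX (Ne.symm hTT') heT heT' heX hc).resolve_left
            hXA
          rw [this, h0]; simp
        · rw [hI0 X hX heX, mul_zero]
      · exact fun h => absurd hA h
  have hne : M.triangles.Nonempty := Finset.card_pos.1 (by omega)
  obtain ⟨T₀, hT₀⟩ := hne
  refine ⟨α T₀, fun x hx => ?_⟩
  have hκ : ∀ T ∈ M.triangles, ∀ x ∈ convexHull ℝ (T : Set Plane), q x = α T := by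
    intro T hT x hx
    rw [hα T hT x hx, hgrad T hT]
    simp
  obtain ⟨T, hT, hxT⟩ := M.mem_region.1 hx
  rw [hκ T hT x hxT, hconn.eq_of_piecewise_const hκ hT hT₀]

/-! ### The bilinear forms -/

lemma partialDeriv_add {u v : Plane → Plane} {x : Plane} (hu : DifferentiableAt ℝ u x)
    (hv : DifferentiableAt ℝ v x) (c d : Fin 2) :
    partialDeriv (u + v) c d x = partialDeriv u c d x + partialDeriv v c d x := by
  simp [partialDeriv, fderiv_add hu hv]

lemma partialDeriv_smul {u : Plane → Plane} {x : Plane} (hu : DifferentiableAt ℝ u x) (r : ℝ)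
    (c d : Fin 2) : partialDeriv (r • u) c d x = r * partialDeriv u c d x := by
  simp [partialDeriv, fderiv_const_smul hu]

lemma formA_comm (ν : ℝ) (u v : Plane → Plane) : formA M ν u v = formA M ν v u := by
  simp only [formA, mul_comm (partialDeriv u _ _ _)]

lemma formA_integrand {u v : Plane → Plane} (hu : PiecewiseSmooth M u)
    (hv : PiecewiseSmooth M v) :
    PiecewiseContinuous M fun x => ∑ c, ∑ d, partialDeriv u c d x * partialDeriv v c d x :=
  PiecewiseContinuous.sum _ fun c _ => PiecewiseContinuous.sum _ fun d _ =>
    (hu.partialDeriv c d).mul (hv.partialDeriv c d)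

lemma formA_add_left (ν : ℝ) {u u' v : Plane → Plane} (hu : PiecewiseSmooth M u)
    (hu' : PiecewiseSmooth M u') (hv : PiecewiseSmooth M v) :
    formA M ν (u + u') v = formA M ν u v + formA M ν u' v := by
  rw [formA, formA, formA, ← mul_add, ← integral_add (formA_integrand hu hv).integrableOn
    (formA_integrand hu' hv).integrableOn]
  congr 1
  refine integral_congr_ae (M.ae_region fun T hT x hx => ?_)
  simp only [partialDeriv_add (hu.differentiableAt hT hx) (hu'.differentiableAt hT hx), add_mul,
    Finset.sum_add_distrib]

lemma formA_smul_left (ν r : ℝ) {u v : Plane → Plane} (hu : PiecewiseSmooth M u) :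
    formA M ν (r • u) v = r * formA M ν u v := by
  rw [formA, formA, mul_left_comm, ← integral_const_mul r]
  congr 1
  refine integral_congr_ae (M.ae_region fun T hT x hx => ?_)
  simp only [partialDeriv_smul (hu.differentiableAt hT hx), Finset.mul_sum, mul_assoc]

lemma formB_add_left {u v : Plane → Plane} {q : Plane → ℝ} (hu : PiecewiseSmooth M u)
    (hv : PiecewiseSmooth M v) (hq : PiecewiseSmooth M q) :
    formB M (u + v) q = formB M u q + formB M v q := by
  rw [formB, formB, formB, ← neg_add, ← integral_add
    (hq.piecewiseContinuous.mul hu.div).integrableOn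
    (hq.piecewiseContinuous.mul hv.div).integrableOn]
  congr 1
  refine integral_congr_ae (M.ae_region fun T hT x hx => ?_)
  simp only [partialDeriv_add (hu.differentiableAt hT hx) (hv.differentiableAt hT hx),
    Finset.sum_add_distrib, mul_add]

lemma formB_smul_left (r : ℝ) {u : Plane → Plane} {q : Plane → ℝ} (hu : PiecewiseSmooth M u) :
    formB M (r • u) q = r * formB M u q := by
  rw [formB, formB, mul_neg, ← integral_const_mul]
  congr 1
  refine integral_congr_ae (M.ae_region fun T hT x hx => ?_)
  simp only [partialDeriv_smul (hu.differentiableAt hT hx), ← Finset.mul_sum, mul_left_comm]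

lemma formB_add_right {u : Plane → Plane} {q q' : Plane → ℝ} (hu : PiecewiseSmooth M u)
    (hq : PiecewiseSmooth M q) (hq' : PiecewiseSmooth M q') :
    formB M u (q + q') = formB M u q + formB M u q' := by
  rw [formB, formB, formB, ← neg_add, ← integral_add
    (hq.piecewiseContinuous.mul hu.div).integrableOn
    (hq'.piecewiseContinuous.mul hu.div).integrableOn]
  simp only [Pi.add_apply, add_mul]

lemma formB_smul_right (r : ℝ) (u : Plane → Plane) (q : Plane → ℝ) :
    formB M u (r • q) = r * formB M u q := by
  rw [formB, formB, mul_neg, ← integral_const_mul]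
  simp only [Pi.smul_apply, smul_eq_mul, mul_assoc]

/-- `formA` as a bilinear form. -/
def bilinA (M : TriMesh) (W : Finset (Finset Plane)) (ν : ℝ) :
    velocitySpace M W →ₗ[ℝ] velocitySpace M W →ₗ[ℝ] ℝ :=
  LinearMap.mk₂ ℝ (fun u v => formA M ν u v)
    (fun u u' v => formA_add_left ν (piecewiseSmooth_of_mem_velocitySpace u.2)
      (piecewiseSmooth_of_mem_velocitySpace u'.2) (piecewiseSmooth_of_mem_velocitySpace v.2))
    (fun r u v => formA_smul_left ν r (piecewiseSmooth_of_mem_velocitySpace u.2))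
    (fun u v v' => by
      rw [formA_comm, formA_comm ν _ (v : Plane → Plane), formA_comm ν _ (v' : Plane → Plane)]
      exact formA_add_left ν (piecewiseSmooth_of_mem_velocitySpace v.2)
        (piecewiseSmooth_of_mem_velocitySpace v'.2) (piecewiseSmooth_of_mem_velocitySpace u.2))
    (fun r u v => by
      rw [formA_comm, formA_comm ν _ (v : Plane → Plane)]
      exact formA_smul_left ν r (piecewiseSmooth_of_mem_velocitySpace v.2))

/-- `formB` as a bilinear form. -/
def bilinB (M : TriMesh) (W : Finset (Finset Plane)) :
    velocitySpace M W →ₗ[ℝ] pressureSpace M →ₗ[ℝ] ℝ :=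
  LinearMap.mk₂ ℝ (fun u q => formB M u q)
    (fun u u' q => formB_add_left (piecewiseSmooth_of_mem_velocitySpace u.2)
      (piecewiseSmooth_of_mem_velocitySpace u'.2) (piecewiseSmooth_of_mem_lagrangeSpace q.2))
    (fun r u _ => formB_smul_left r (piecewiseSmooth_of_mem_velocitySpace u.2))
    (fun u q q' => formB_add_right (piecewiseSmooth_of_mem_velocitySpace u.2)
      (piecewiseSmooth_of_mem_lagrangeSpace q.2) (piecewiseSmooth_of_mem_lagrangeSpace q'.2))
    (fun r u q => formB_smul_right r u q)

lemma formA_self_nonneg {ν : ℝ} (hν : 0 ≤ ν) (u : Plane → Plane) : 0 ≤ formA M ν u u :=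
  mul_nonneg hν (integral_nonneg fun _ =>
    Finset.sum_nonneg fun _ _ => Finset.sum_nonneg fun _ _ => mul_self_nonneg _)

/-- The integrand is a sum of squares, hence zero almost everywhere. Inside the triangle it
coincides with the continuous one of a smooth extension, so the gradient vanishes everywhere there,
and constancy passes to the closure. -/
lemma exists_const_of_formA_eq_zero {ν : ℝ} (hν : 0 < ν) {u : Plane → Plane}
    (hu : PiecewiseSmooth M u) (h : formA M ν u u = 0) {T : Finset Plane} (hT : T ∈ M.triangles) :
    ∃ κ, ∀ x ∈ convexHull ℝ (T : Set Plane), u x = κ := by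
  have hpc := formA_integrand hu hu
  have hnn : ∀ x, 0 ≤ ∑ c, ∑ d, partialDeriv u c d x * partialDeriv u c d x := fun _ =>
    Finset.sum_nonneg fun _ _ => Finset.sum_nonneg fun _ _ => mul_self_nonneg _
  have h0 := (mul_eq_zero.1 h).resolve_left hν.ne'
  rw [hpc.setIntegral_region, Finset.sum_eq_zero_iff_of_nonneg
    fun T _ => integral_nonneg hnn] at h0
  obtain ⟨w, hw, huw⟩ := hu T hT
  set U := interior (convexHull ℝ (T : Set Plane)) with hU
  have hc : Continuous fun x => ∑ c, ∑ d, partialDeriv w c d x * partialDeriv w c d x :=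
    continuous_finsetSum _ fun c _ => continuous_finsetSum _ fun d _ =>
      (continuous_partialDeriv hw c d).mul (continuous_partialDeriv hw c d)
  have hae := (integral_eq_zero_iff_of_nonneg hnn (hpc.integrableOn_hull hT)).1 (h0 T hT)
  rw [← restrict_interior_hull] at hae
  have hae' : (fun x => ∑ c, ∑ d, partialDeriv w c d x * partialDeriv w c d x)
      =ᵐ[volume.restrict U] 0 := by
    filter_upwards [hae, ae_restrict_mem isOpen_interior.measurableSet] with x hx hxU
    rw [← hx]
    simp only [partialDeriv_eq_of_eqOn huw hxU]
  have hz := Measure.eqOn_open_of_ae_eq hae' isOpen_interior hc.continuousOn continuousOn_const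
  have hfd : U.EqOn (fderiv ℝ w) 0 := by
    intro x hx
    have h1 := hz hx
    simp only [Pi.zero_apply] at h1
    have h2 : ∀ c d, partialDeriv w c d x = 0 := by
      intro c d
      rw [Finset.sum_eq_zero_iff_of_nonneg
        fun _ _ => Finset.sum_nonneg fun _ _ => mul_self_nonneg _] at h1
      have h3 := h1 c (Finset.mem_univ c)
      rw [Finset.sum_eq_zero_iff_of_nonneg fun _ _ => mul_self_nonneg _] at h3
      exact mul_self_eq_zero.1 (h3 d (Finset.mem_univ d))
    ext y c
    have hy : y = y 0 • EuclideanSpace.single 0 (1 : ℝ) + y 1 • EuclideanSpace.single 1 (1 : ℝ) := by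
      ext i; fin_cases i <;> simp
    have h20 := h2 c 0
    have h21 := h2 c 1
    simp only [partialDeriv] at h20 h21
    rw [hy, map_add, map_smul, map_smul]
    simp [h20, h21]
  obtain ⟨x₀, hx₀⟩ := M.nonempty_interior_hull hT
  have hconst : U.EqOn w fun _ => w x₀ := fun x hx =>
    isOpen_interior.is_const_of_fderiv_eq_zero
      (convex_convexHull ℝ _).interior.isPreconnected
      (hw.differentiable one_ne_zero).differentiableOn hfd hx hx₀
  have hcl := hconst.closure hw.continuous continuous_const
  rw [hU, M.closure_interior_hull hT] at hcl
  exact ⟨w x₀, fun x hx => (huw hx).trans (hcl hx)⟩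

/-- The velocity form is definite if the velocity vanishes on some edge. -/
lemma eq_zero_of_formA_eq_zero (hconn : M.EdgeConnected) {ν : ℝ} (hν : 0 < ν)
    {W : Finset (Finset Plane)} (hW : W ⊆ M.boundaryEdges) (hne : W.Nonempty) {u : Plane → Plane}
    (hu : u ∈ velocitySpace M W) (h : formA M ν u u = 0) : u = 0 := by
  classical
  choose! κ hκ using fun (T : Finset Plane) (hT : T ∈ M.triangles) =>
    exists_const_of_formA_eq_zero hν (piecewiseSmooth_of_mem_velocitySpace hu) h hT
  obtain ⟨e, he⟩ := hne
  obtain ⟨T₀, hT₀, heT, hc⟩ := M.exists_of_mem_edges (Finset.mem_filter.1 (hW he)).1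
  obtain ⟨y, hy⟩ := Finset.card_pos.1 (by omega : 0 < e.card)
  have h0 : κ T₀ = 0 := by
    rw [← hκ T₀ hT₀ y (subset_convexHull ℝ _ (heT hy))]
    exact hu.2 e he y (subset_convexHull ℝ _ hy)
  ext x c
  by_cases hx : x ∈ M.region
  · obtain ⟨T, hT, hxT⟩ := M.mem_region.1 hx
    rw [hκ T hT x hxT, hconn.eq_of_piecewise_const hκ hT hT₀, h0]
    rfl
  -- Off the region, discrete functions are extended by zero.
  · exact (hu.1 c).2.2 x hx

/-! ### Linearity of the flux -/

/-- Additivity needs integrability along the edge, which comes from the smooth extensions on the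
triangle. -/
lemma triFlux_add {T e : Finset Plane} (hT : T ∈ M.triangles) (heT : e ⊆ T) (hc : e.card = 2)
    {v w : Plane → Plane} (hv : PiecewiseSmooth M v) (hw : PiecewiseSmooth M w) :
    triFlux T e (v + w) = triFlux T e v + triFlux T e w := by
  classical
  obtain ⟨v', hv', hvv'⟩ := hv T hT
  obtain ⟨w', hw', hww'⟩ := hw T hT
  have hsub : convexHull ℝ (e : Set Plane) ⊆ convexHull ℝ (T : Set Plane) :=
    convexHull_mono (Finset.coe_subset.2 heT)
  rw [triFlux_congr (hvv'.mono hsub), triFlux_congr (hww'.mono hsub),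
    triFlux_congr (w := v' + w') fun x hx => by simp [hvv' (hsub hx), hww' (hsub hx)]]
  obtain ⟨a, b, hab, h⟩ := Finset.card_eq_two.1 hc
  obtain rfl : e = {a, b} := by convert h
  obtain ⟨c, hca, hcb, rfl⟩ := M.exists_apex hT hab heT
  have hne := M.cross_ne_zero hT rfl
  rw [triFlux_eq hne, triFlux_eq hne, triFlux_eq hne, ← mul_add,
    ← intervalIntegral.integral_add]
  · simp only [Pi.add_apply, cross_add]
  · exact ((contDiff_cross_right hv' _).continuous.comp (by fun_prop)).intervalIntegrable _ _
  · exact ((contDiff_cross_right hw' _).continuous.comp (by fun_prop)).intervalIntegrable _ _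

lemma edgeFlux_add {e : Finset Plane} (he : e ∈ M.edges) {v w : Plane → Plane}
    (hv : PiecewiseSmooth M v) (hw : PiecewiseSmooth M w) :
    M.edgeFlux (v + w) e = M.edgeFlux v e + M.edgeFlux w e := by
  classical
  obtain ⟨_, _, _, hc⟩ := M.exists_of_mem_edges he
  rw [edgeFlux_eq, edgeFlux_eq, edgeFlux_eq, ← Finset.sum_add_distrib]
  refine Finset.sum_congr rfl fun T hT => ?_
  rw [Finset.mem_filter] at hT
  exact triFlux_add hT.1 hT.2 hc hv hw

lemma edgeFlux_smul (r : ℝ) (v : Plane → Plane) (e : Finset Plane) :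
    M.edgeFlux (r • v) e = r * M.edgeFlux v e := by
  classical
  rw [edgeFlux_eq, edgeFlux_eq, Finset.mul_sum]
  refine Finset.sum_congr rfl fun T _ => ?_
  rw [triFlux, triFlux, ← integral_const_mul]
  simp only [Pi.smul_apply, inner_smul_left]
  rfl

/-! ### Constant pressures -/

/-- The constant function `1` is a discrete pressure. -/
lemma indicator_one_mem_pressureSpace (M : TriMesh) :
    M.region.indicator (fun _ => (1 : ℝ)) ∈ pressureSpace M := by
  refine ⟨continuousOn_const.congr fun x hx => Set.indicator_of_mem hx _,
    fun T hT => ⟨1, by simp, fun x hx => ?_⟩, fun x hx => Set.indicator_of_notMem hx _⟩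
  rw [Set.indicator_of_mem (M.hull_subset_region hT hx)]
  simp

lemma measurableSet_region (M : TriMesh) : MeasurableSet M.region :=
  Finset.measurableSet_biUnion _ fun T _ => (isCompact_hull T).measurableSet

lemma formB_of_eq_const {v : Plane → Plane} (hv : PiecewiseSmooth M v) {q : Plane → ℝ} {c : ℝ}
    (hq : ∀ x ∈ M.region, q x = c) :
    formB M v q = -(c * ∑ e ∈ M.boundaryEdges, M.edgeFlux v e) := by
  rw [formB, ← setIntegral_region_div hv, ← integral_const_mul]
  congr 1
  refine setIntegral_congr_fun (measurableSet_region M) fun x hx => ?_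
  simp only [hq x hx]

/-! ### Saddle point systems -/

section Saddle

variable {V Q ι κ : Type*} [AddCommGroup V] [Module ℝ V] [AddCommGroup Q] [Module ℝ Q]
  [Fintype ι] [Fintype κ]
  (φ : Module.Basis ι ℝ V) (ψ : Module.Basis κ ℝ Q) (a : V →ₗ[ℝ] V →ₗ[ℝ] ℝ) (b : V →ₗ[ℝ] Q →ₗ[ℝ] ℝ)

/-- The matrix of a saddle point problem. -/
def saddleMatrix : Matrix (ι ⊕ κ) (ι ⊕ κ) ℝ :=
  Matrix.fromBlocks (Matrix.of fun j k => a (φ k) (φ j)) (Matrix.of fun l j => b (φ j) (ψ l))ᵀ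
    (Matrix.of fun l j => b (φ j) (ψ l)) 0

/-- Two linear functionals agree once they agree on a basis. This is the passage between the
coefficient system and the variational problem. -/
lemma saddleMatrix_mulVec_eq_iff (U : ι ⊕ κ → ℝ) (F : V →ₗ[ℝ] ℝ) :
    saddleMatrix φ ψ a b *ᵥ U = Sum.elim (fun j => F (φ j)) 0 ↔
      (∀ v, a (φ.equivFun.symm (U ∘ Sum.inl)) v + b v (ψ.equivFun.symm (U ∘ Sum.inr)) = F v) ∧
        ∀ q, b (φ.equivFun.symm (U ∘ Sum.inl)) q = 0 := by
  set u := φ.equivFun.symm (U ∘ Sum.inl) with hu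
  set p := ψ.equivFun.symm (U ∘ Sum.inr) with hp
  have h1 : saddleMatrix φ ψ a b *ᵥ U =
      Sum.elim (fun j => (a u + b.flip p) (φ j)) (fun l => b u (ψ l)) := by
    rw [saddleMatrix, Matrix.fromBlocks_mulVec]
    congr 1
    · ext j
      simp [hu, hp, Module.Basis.equivFun_symm_apply, Matrix.mulVec, dotProduct, mul_comm]
    · ext l
      simp [hu, Module.Basis.equivFun_symm_apply, Matrix.mulVec, dotProduct, mul_comm]
  rw [h1, Sum.elim_eq_iff]
  refine and_congr ?_ ?_
  · constructor
    · intro h v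
      have : a u + b.flip p = F := φ.ext fun j => congrFun h j
      rw [← this]; rfl
    · intro h
      ext j
      exact h (φ j)
  · constructor
    · intro h q
      have : b u = 0 := ψ.ext fun l => congrFun h l
      rw [this]; rfl
    · intro h
      ext l
      exact h (ψ l)

variable {a b}

/-- For a kernel element, testing the first equation with the velocity itself and using the second
leaves `a u u = 0`; then the pressure is annihilated by all velocities. In finite dimension,
injectivity suffices. -/
lemma isUnit_saddleMatrix [DecidableEq ι] [DecidableEq κ] (ha : ∀ u, a u u = 0 → u = 0)
    (hb : ∀ p, (∀ v, b v p = 0) → p = 0) : IsUnit (saddleMatrix φ ψ a b) := by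
  rw [← Matrix.mulVec_injective_iff_isUnit]
  refine (injective_iff_map_eq_zero (saddleMatrix φ ψ a b).mulVecLin).2 fun U hU => ?_
  have h := (saddleMatrix_mulVec_eq_iff φ ψ a b U 0).1 (by
    rw [← Matrix.mulVecLin_apply, hU]; ext (j | l) <;> rfl)
  have hu : φ.equivFun.symm (U ∘ Sum.inl) = 0 := ha _ (by
    have h1 := h.1 (φ.equivFun.symm (U ∘ Sum.inl))
    rwa [h.2, add_zero] at h1)
  have hp : ψ.equivFun.symm (U ∘ Sum.inr) = 0 := hb _ fun v => by
    have h1 := h.1 v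
    rw [hu, map_zero] at h1
    rwa [LinearMap.zero_apply, zero_add] at h1
  have hu' := (LinearEquiv.map_eq_zero_iff _).1 hu
  have hp' := (LinearEquiv.map_eq_zero_iff _).1 hp
  ext (j | l)
  · exact congrFun hu' j
  · exact congrFun hp' l

end Saddle

namespace PoreDecomposition

variable {N m mk : ℕ} (D : PoreDecomposition N m mk)

/-! ### Edges and faces of a pore -/

lemma wall_subset (i : Fin N) : D.wall i ⊆ (D.mesh i).boundaryEdges := Finset.filter_subset _ _

lemma boundaryEdges_subset (i : Fin N) : (D.mesh i).boundaryEdges ⊆ (D.mesh i).edges := by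
  classical exact Finset.filter_subset _ _

lemma faceEdges_subset (i : Fin N) (r : D.LFace i) :
    D.faceEdges i r ⊆ (D.mesh i).boundaryEdges := D.face_subset i _

lemma faceEdges_nonempty (i : Fin N) (r : D.LFace i) : (D.faceEdges i r).Nonempty := by
  rcases r with r | r
  · exact r.2
  · exact r.2

lemma notMem_wall {i : Fin N} {r : D.LFace i} {e : Finset Plane} (he : e ∈ D.faceEdges i r) :
    e ∉ D.wall i := by
  classical
  exact fun h => (Finset.mem_filter.1 h).2 _ he

lemma eq_of_mem_faceEdges {i : Fin N} {r s : D.LFace i} {e : Finset Plane}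
    (hr : e ∈ D.faceEdges i r) (hs : e ∈ D.faceEdges i s) : r = s := by
  by_contra hne
  refine Finset.disjoint_left.1 (D.face_disjoint i _ _ fun h => hne ?_) hr hs
  exact Sum.map_injective.2 ⟨Subtype.val_injective, Subtype.val_injective⟩ h

lemma sum_UFace (i : Fin N) (f : Finset Plane → ℝ) :
    ∑ r : D.UFace i, ∑ e ∈ D.face i (Sum.inl r.1), f e =
      ∑ α, ∑ e ∈ D.face i (Sum.inl α), f e := by
  classical
  rw [← Finset.sum_subtype (Finset.univ.filter fun α => (D.face i (Sum.inl α)).Nonempty)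
    (by simp) fun α => ∑ e ∈ D.face i (Sum.inl α), f e, Finset.sum_filter_of_ne]
  intro α _ h
  by_contra hn
  rw [Finset.not_nonempty_iff_eq_empty] at hn
  exact h (by rw [hn, Finset.sum_empty])

lemma sum_KFace (i : Fin N) (f : Finset Plane → ℝ) :
    ∑ r : D.KFace i, ∑ e ∈ D.face i (Sum.inr r.1), f e =
      ∑ k, ∑ e ∈ D.face i (Sum.inr k), f e := by
  classical
  rw [← Finset.sum_subtype (Finset.univ.filter fun α => (D.face i (Sum.inr α)).Nonempty)
    (by simp) fun α => ∑ e ∈ D.face i (Sum.inr α), f e, Finset.sum_filter_of_ne]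
  intro α _ h
  by_contra hn
  rw [Finset.not_nonempty_iff_eq_empty] at hn
  exact h (by rw [hn, Finset.sum_empty])

/-- Wall and faces partition the boundary edges. Local faces may be traded for global indices
because faces that the pore does not touch are empty. -/
lemma sum_boundaryEdges (i : Fin N) (f : Finset Plane → ℝ) :
    ∑ e ∈ (D.mesh i).boundaryEdges, f e =
      ∑ e ∈ D.wall i, f e + ∑ r, ∑ e ∈ D.faceEdges i r, f e := by
  classical
  rw [Fintype.sum_sum_type]
  simp only [faceEdges, Sum.map_inl, Sum.map_inr]
  rw [sum_UFace, sum_KFace, ← Fintype.sum_sum_type (fun r => ∑ e ∈ D.face i r, f e),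
    ← Finset.sum_biUnion fun r _ s _ h => D.face_disjoint i r s h, wall,
    ← Finset.sum_filter_add_sum_filter_not (D.mesh i).boundaryEdges (fun e => ∀ r, e ∉ D.face i r)]
  congr 1
  refine Finset.sum_congr ?_ fun _ _ => rfl
  ext e
  simp only [Finset.mem_filter, Finset.mem_biUnion, Finset.mem_univ, true_and, not_forall, not_not]
  exact ⟨fun h => h.2, fun ⟨r, hr⟩ => ⟨D.face_subset i r hr, r, hr⟩⟩

lemma sum_boundaryEdges_eq_exterior_add (i : Fin N) (f : Finset Plane → ℝ) :
    ∑ e ∈ (D.mesh i).boundaryEdges, f e =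
      ∑ e ∈ D.exteriorEdges i, f e + ∑ r : D.UFace i, ∑ e ∈ D.faceEdges i (Sum.inl r), f e := by
  classical
  simp only [faceEdges, Sum.map_inl]
  rw [sum_UFace, ← Finset.sum_biUnion fun r _ s _ h =>
      D.face_disjoint i _ _ fun h' => h (Sum.inl_injective h'), exteriorEdges,
    ← Finset.sum_filter_add_sum_filter_not (D.mesh i).boundaryEdges
      (fun e => ∀ α : Fin m, e ∉ D.face i (Sum.inl α))]
  congr 1
  refine Finset.sum_congr ?_ fun _ _ => rfl
  ext e
  simp only [Finset.mem_filter, Finset.mem_biUnion, Finset.mem_univ, true_and, not_forall, not_not]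
  exact ⟨fun h => h.2, fun ⟨r, hr⟩ => ⟨D.face_subset i _ hr, r, hr⟩⟩

lemma piecewiseSmooth (i : Fin N) (v : D.V i) : PiecewiseSmooth (D.mesh i) (v : Plane → Plane) :=
  piecewiseSmooth_of_mem_velocitySpace v.2

/-- The flux through a face as a linear functional. -/
def faceFluxLin (i : Fin N) (r : D.LFace i) : D.V i →ₗ[ℝ] ℝ where
  toFun v := D.faceFlux i r v
  map_add' v w := by
    simp only [faceFlux, ← Finset.sum_add_distrib]
    exact Finset.sum_congr rfl fun e he =>
      edgeFlux_add (D.boundaryEdges_subset i (D.faceEdges_subset i r he)) (D.piecewiseSmooth i v)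
        (D.piecewiseSmooth i w)
  map_smul' c v := by
    simp only [faceFlux, RingHom.id_apply, smul_eq_mul, Finset.mul_sum]
    exact Finset.sum_congr rfl fun e _ => edgeFlux_smul c v e

@[simp] lemma faceFluxLin_apply (i : Fin N) (r : D.LFace i) (v : D.V i) :
    D.faceFluxLin i r v = D.faceFlux i r v := rfl

/-- The bilinear form `a` of a pore. -/
abbrev aForm (ν : ℝ) (i : Fin N) : D.V i →ₗ[ℝ] D.V i →ₗ[ℝ] ℝ := bilinA (D.mesh i) (D.wall i) ν

/-- The bilinear form `b` of a pore. -/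
abbrev bForm (i : Fin N) : D.V i →ₗ[ℝ] D.Q i →ₗ[ℝ] ℝ := bilinB (D.mesh i) (D.wall i)

lemma sum_edgeFlux_eq (i : Fin N) (v : D.V i) :
    ∑ e ∈ (D.mesh i).boundaryEdges, (D.mesh i).edgeFlux v e = ∑ r, D.faceFlux i r v := by
  rw [sum_boundaryEdges, Finset.sum_eq_zero fun e he => edgeFlux_eq_zero (v.2.2 e he), zero_add]
  rfl

/-- The total flux of a discretely divergence free velocity vanishes. -/
lemma sum_faceFlux_eq_zero (i : Fin N) {v : D.V i} (hv : ∀ q, D.bForm i v q = 0) :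
    ∑ r, D.faceFlux i r v = 0 := by
  -- Test with the constant pressure 1.
  have h := hv ⟨_, indicator_one_mem_pressureSpace (D.mesh i)⟩
  change formB (D.mesh i) v _ = 0 at h
  rw [formB_of_eq_const (D.piecewiseSmooth i v) (c := 1)
    fun x hx => Set.indicator_of_mem hx fun _ => (1 : ℝ), one_mul, neg_eq_zero, sum_edgeFlux_eq] at h
  exact h

/-! ### Local solvability -/

/-- A pressure which balances constant tractions on the faces is constant and equal to each of
these tractions. -/
lemma exists_const_of_balance {i : Fin N} (hconn : (D.mesh i).EdgeConnected)
    (hcard : 3 ≤ (D.mesh i).triangles.card) (t : D.LFace i → ℝ) (q : D.Q i)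
    (h : ∀ v, D.bForm i v q = -∑ r, t r * D.faceFlux i r v) :
    ∃ c, (∀ x ∈ (D.mesh i).region, (q : Plane → ℝ) x = c) ∧ ∀ r, t r = c := by
  -- Velocities vanishing on the whole boundary carry no face flux, so the balance makes `q`
  -- orthogonal to their divergences.
  obtain ⟨c, hc⟩ := exists_const_of_formB_eq_zero hconn hcard q.2 fun v hv => by
    refine (h ⟨v, velocitySpace_mono (D.wall_subset i) hv⟩).trans ?_
    rw [neg_eq_zero]
    refine Finset.sum_eq_zero fun r _ => ?_
    rw [faceFlux, Finset.sum_eq_zero, mul_zero]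
    exact fun e he => edgeFlux_eq_zero (hv.2 e (D.faceEdges_subset i r he))
  refine ⟨c, hc, fun r => ?_⟩
  obtain ⟨e, he⟩ := D.faceEdges_nonempty i r
  have heb := D.faceEdges_subset i r he
  -- With flux through the single edge `e` of face `r`, the balance reads `c` times this flux equals
  -- `t r` times it.
  obtain ⟨v, hv, hv0, hne⟩ := exists_edgeFlux_ne_zero heb
  have hvV : v ∈ D.V i := hv _ (D.wall_subset i) (D.notMem_wall he)
  have hz : ∀ e' ∈ (D.mesh i).boundaryEdges, e' ≠ e → (D.mesh i).edgeFlux v e' = 0 :=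
    fun e' he' hn => edgeFlux_eq_zero (hv0 e' he' hn)
  have h1 := h ⟨v, hvV⟩
  change formB (D.mesh i) v q = _ at h1
  rw [formB_of_eq_const (piecewiseSmooth_of_mem_velocitySpace hvV) hc, neg_inj,
    Finset.sum_eq_single e hz fun hn => absurd heb hn, Finset.sum_eq_single r] at h1
  · rw [faceFlux, Finset.sum_eq_single e (fun e' he' => hz e' (D.faceEdges_subset i r he'))
      fun hn => absurd he hn] at h1
    exact (mul_right_cancel₀ hne h1).symm
  · intro s _ hs
    rw [faceFlux, Finset.sum_eq_zero, mul_zero]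
    intro e' he'
    refine hz e' (D.faceEdges_subset i s he') ?_
    rintro rfl
    exact hs (D.eq_of_mem_faceEdges he' he)
  · exact fun hn => absurd (Finset.mem_univ r) hn

lemma eq_zero_of_aForm_eq_zero {i : Fin N} (hconn : (D.mesh i).EdgeConnected)
    (hwall : (D.wall i).Nonempty) {ν : ℝ} (hν : 0 < ν) (u : D.V i) (h : D.aForm ν i u u = 0) :
    u = 0 :=
  Subtype.ext (eq_zero_of_formA_eq_zero hconn hν (D.wall_subset i) hwall u.2 h)

/-- The case of zero tractions in the balance lemma. A face is needed to exclude nonzero constants.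
-/
lemma eq_zero_of_bForm_eq_zero {i : Fin N} (hconn : (D.mesh i).EdgeConnected)
    (hcard : 3 ≤ (D.mesh i).triangles.card) (hface : Nonempty (D.LFace i)) (q : D.Q i)
    (h : ∀ v, D.bForm i v q = 0) : q = 0 := by
  obtain ⟨c, hc, hr⟩ := D.exists_const_of_balance hconn hcard 0 q fun v => by simp [h v]
  obtain ⟨r⟩ := hface
  have hc0 : c = 0 := (hr r).symm
  ext x
  by_cases hx : x ∈ (D.mesh i).region
  · exact (hc x hx).trans hc0
  · exact q.2.2.2 x hx

/-- Either the chain is trivial and the pore has an inlet/outlet face, or its first step crosses an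
internal one. -/
lemma nonempty_LFace {i : Fin N}
    (h : ∃ j, Relation.ReflTransGen D.Adjacent i j ∧ Nonempty (D.KFace j)) :
    Nonempty (D.LFace i) := by
  obtain ⟨j, hij, ⟨k⟩⟩ := h
  rcases hij.cases_head with rfl | ⟨_, ⟨-, α, hα, -⟩, -⟩
  · exact ⟨Sum.inr k⟩
  · exact ⟨Sum.inl ⟨α, hα⟩⟩

lemma matK_eq (ν : ℝ) (i : Fin N) {ι κ : Type*} (φ : Module.Basis ι ℝ (D.V i))
    (ψ : Module.Basis κ ℝ (D.Q i)) :
    D.matK ν i φ ψ = saddleMatrix φ ψ (D.aForm ν i) (D.bForm i) := rfl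

section Local

variable (ν : ℝ) (i : Fin N) {ι κ : Type*} [Fintype ι] [DecidableEq ι] [Fintype κ] [DecidableEq κ]
  (φ : Module.Basis ι ℝ (D.V i)) (ψ : Module.Basis κ ℝ (D.Q i))

/-- The velocity response to unit normal traction on a face. -/
def responseField (r : D.LFace i) : D.V i := φ.equivFun.symm (D.response ν i φ ψ r)

/-- The velocity response to given tractions. -/
def tractionField (t : D.LFace i → ℝ) : D.V i := ∑ r, t r • D.responseField ν i φ ψ r

/-- The minus sign of `load` cancels that of `matG`. -/
lemma matG_apply (k r : D.LFace i) :
    D.matG ν i φ ψ k r = D.faceFlux i k (D.responseField ν i φ ψ r) := by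
  rw [← faceFluxLin_apply, responseField, Module.Basis.equivFun_symm_apply, map_sum]
  simp [matG, dotProduct, load, mul_comm]

lemma matG_mulVec (t : D.LFace i → ℝ) (k : D.LFace i) :
    (D.matG ν i φ ψ *ᵥ t) k = D.faceFlux i k (D.tractionField ν i φ ψ t) := by
  rw [← faceFluxLin_apply, tractionField, map_sum]
  simp [Matrix.mulVec, dotProduct, matG_apply, mul_comm]

lemma velocity_eq (pk : Fin mk → ℝ) (p : Fin m → ℝ) :
    D.velocity ν i φ ψ pk p = D.tractionField ν i φ ψ (D.localTraction i pk p) := by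
  simp only [velocity, tractionField, responseField, Module.Basis.equivFun_symm_apply,
    Finset.smul_sum, Submodule.coe_sum, Submodule.coe_smul, Finset.sum_smul, smul_smul]
  exact Finset.sum_comm

variable {ν i φ ψ}

/-- Superposition of the unit responses. Invertibility of `matK` is what makes `response` an actual
solution. -/
lemma exists_pressure (hK : IsUnit (D.matK ν i φ ψ)) (t : D.LFace i → ℝ) :
    ∃ X : D.Q i,
      (∀ v, D.aForm ν i (D.tractionField ν i φ ψ t) v + D.bForm i v X =
        -∑ r, t r * D.faceFlux i r v) ∧
      ∀ q, D.bForm i (D.tractionField ν i φ ψ t) q = 0 := by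
  have h1 : ∀ r, ∃ X : D.Q i,
      (∀ v, D.aForm ν i (D.responseField ν i φ ψ r) v + D.bForm i v X = -D.faceFlux i r v) ∧
      ∀ q, D.bForm i (D.responseField ν i φ ψ r) q = 0 := by
    intro r
    set U := (D.matK ν i φ ψ)⁻¹ *ᵥ Sum.elim (D.load i φ r) (0 : κ → ℝ) with hU
    have hKU : saddleMatrix φ ψ (D.aForm ν i) (D.bForm i) *ᵥ U =
        Sum.elim (fun j => (-D.faceFluxLin i r) (φ j)) 0 := by
      rw [← matK_eq, hU, Matrix.mulVec_mulVec,
        Matrix.mul_nonsing_inv _ ((Matrix.isUnit_iff_isUnit_det _).1 hK), Matrix.one_mulVec]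
      rfl
    obtain ⟨h1, h2⟩ := (saddleMatrix_mulVec_eq_iff φ ψ _ _ U _).1 hKU
    exact ⟨_, h1, h2⟩
  choose X hX hX' using h1
  refine ⟨∑ r, t r • X r, fun v => ?_, fun q => ?_⟩
  · simp only [tractionField, map_sum, map_smul, LinearMap.sum_apply, LinearMap.smul_apply]
    rw [← Finset.sum_add_distrib, ← Finset.sum_neg_distrib]
    refine Finset.sum_congr rfl fun r _ => ?_
    rw [← smul_add, hX r v, smul_eq_mul, mul_neg]
  · simp only [tractionField, map_sum, map_smul, LinearMap.sum_apply, LinearMap.smul_apply, hX']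
    simp

/-- Test the momentum equation for `s` with the response to `t`; its discrete incompressibility
removes the pressure term. -/
lemma dotProduct_matG_mulVec (hK : IsUnit (D.matK ν i φ ψ)) (s t : D.LFace i → ℝ) :
    s ⬝ᵥ (D.matG ν i φ ψ *ᵥ t) =
      -D.aForm ν i (D.tractionField ν i φ ψ s) (D.tractionField ν i φ ψ t) := by
  obtain ⟨X, hX, -⟩ := D.exists_pressure hK s
  obtain ⟨-, -, h0⟩ := D.exists_pressure hK t
  have := hX (D.tractionField ν i φ ψ t)
  rw [h0, add_zero] at this
  rw [this, neg_neg]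
  simp only [dotProduct, matG_mulVec]

lemma matG_isSymm (hK : IsUnit (D.matK ν i φ ψ)) : (D.matG ν i φ ψ).IsSymm := by
  ext r s
  have h (r s : D.LFace i) : D.matG ν i φ ψ r s = Pi.single r 1 ⬝ᵥ (D.matG ν i φ ψ *ᵥ Pi.single s 1) := by
    simp
  rw [Matrix.transpose_apply, h, h, dotProduct_matG_mulVec _ hK, dotProduct_matG_mulVec _ hK]
  exact congrArg Neg.neg (formA_comm ν _ _)

end Local

/-! ### The interface system -/

section Global

variable (ν : ℝ) {ι κ : Fin N → Type*} [∀ i, Fintype (ι i)] [∀ i, DecidableEq (ι i)]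
  [∀ i, Fintype (κ i)] [∀ i, DecidableEq (κ i)]
  (φ : ∀ i, Module.Basis (ι i) ℝ (D.V i)) (ψ : ∀ i, Module.Basis (κ i) ℝ (D.Q i))

lemma Ru_mulVec (i : Fin N) (p : Fin m → ℝ) (r : D.UFace i) : (D.Ru i *ᵥ p) r = p r.1 := by
  simp [Ru, Matrix.mulVec, dotProduct]

lemma toBlocks_mulVec (i : Fin N) (pk : Fin mk → ℝ) (p : Fin m → ℝ) (r : D.UFace i) :
    ((D.matG ν i (φ i) (ψ i)).toBlocks₁₁ *ᵥ (D.Ru i *ᵥ p) +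
      (D.matG ν i (φ i) (ψ i)).toBlocks₁₂ *ᵥ (D.Rk i *ᵥ pk)) r =
      (D.matG ν i (φ i) (ψ i) *ᵥ D.localTraction i pk p) (Sum.inl r) := by
  rw [localTraction]
  generalize D.Ru i *ᵥ p = y
  generalize D.Rk i *ᵥ pk = z
  simp [Matrix.mulVec, dotProduct, Matrix.toBlocks₁₁, Matrix.toBlocks₁₂]

/-- The residual of the interface system is the vector of flux imbalances at the interfaces. -/
lemma forcing_sub_schur_mulVec (pk : Fin mk → ℝ) (p : Fin m → ℝ) :
    D.forcing ν φ ψ pk - D.schur ν φ ψ *ᵥ p = ∑ i, (D.Ru i)ᵀ *ᵥ fun r : D.UFace i =>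
      D.faceFlux i (Sum.inl r) (D.velocity ν i (φ i) (ψ i) pk p) := by
  rw [forcing, schur, Matrix.neg_mulVec, sub_neg_eq_add, Matrix.sum_mulVec,
    ← Finset.sum_add_distrib]
  refine Finset.sum_congr rfl fun i _ => ?_
  rw [← Matrix.mulVec_mulVec, ← Matrix.mulVec_mulVec, ← Matrix.mulVec_mulVec,
    ← Matrix.mulVec_mulVec, ← Matrix.mulVec_add, add_comm]
  congr 1
  ext r
  rw [toBlocks_mulVec, matG_mulVec, velocity_eq]

lemma dotProduct_schur_mulVec (hK : ∀ i, IsUnit (D.matK ν i (φ i) (ψ i))) (x : Fin m → ℝ) :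
    x ⬝ᵥ (D.schur ν φ ψ *ᵥ x) = ∑ i, D.aForm ν i
      (D.tractionField ν i (φ i) (ψ i) (D.localTraction i 0 x))
      (D.tractionField ν i (φ i) (ψ i) (D.localTraction i 0 x)) := by
  -- With zero inlet/outlet tractions the forcing vanishes, so `S x` is minus the vector of flux
  -- imbalances. Pairing with `x` is pairing each pore's fluxes with its local tractions, whose
  -- inlet/outlet entries are zero.
  have h := D.forcing_sub_schur_mulVec ν φ ψ 0 x
  have hf : D.forcing ν φ ψ 0 = 0 := by simp [forcing]
  rw [hf, zero_sub, neg_eq_iff_eq_neg] at h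
  rw [h, dotProduct_neg, dotProduct_sum, ← Finset.sum_neg_distrib]
  refine Finset.sum_congr rfl fun i _ => ?_
  rw [Matrix.dotProduct_mulVec, Matrix.vecMul_transpose, eq_comm, ← neg_eq_iff_eq_neg,
    ← dotProduct_matG_mulVec _ (hK i)]
  simp [dotProduct, localTraction, matG_mulVec, velocity_eq]

lemma schur_isSymm (hK : ∀ i, IsUnit (D.matK ν i (φ i) (ψ i))) : (D.schur ν φ ψ).IsSymm := by
  rw [Matrix.IsSymm, schur, Matrix.transpose_neg, Matrix.transpose_sum]
  congr 1
  refine Finset.sum_congr rfl fun i _ => ?_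
  have hs : (D.matG ν i (φ i) (ψ i)).toBlocks₁₁ᵀ = (D.matG ν i (φ i) (ψ i)).toBlocks₁₁ := by
    ext r s
    exact (D.matG_isSymm (hK i)).apply (Sum.inl r) (Sum.inl s)
  rw [Matrix.transpose_mul, Matrix.transpose_mul, Matrix.transpose_transpose, hs, Matrix.mul_assoc]

end Global

section Global

variable {ν : ℝ} {ι κ : Fin N → Type*} [∀ i, Fintype (ι i)] [∀ i, DecidableEq (ι i)]
  [∀ i, Fintype (κ i)] [∀ i, DecidableEq (κ i)]
  {φ : ∀ i, Module.Basis (ι i) ℝ (D.V i)} {ψ : ∀ i, Module.Basis (κ i) ℝ (D.Q i)}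

/-- If interface tractions do not drive any flow, then they vanish. -/
lemma eq_zero_of_tractionField_eq_zero (hν : 0 < ν) (hconn : ∀ i, (D.mesh i).EdgeConnected)
    (hcard : ∀ i, 3 ≤ (D.mesh i).triangles.card) (hwall : ∀ i, (D.wall i).Nonempty)
    (hopen : ∀ i, ∃ j, Relation.ReflTransGen D.Adjacent i j ∧ Nonempty (D.KFace j))
    (hK : ∀ i, IsUnit (D.matK ν i (φ i) (ψ i))) {x : Fin m → ℝ}
    (h : ∀ i, D.aForm ν i (D.tractionField ν i (φ i) (ψ i) (D.localTraction i 0 x))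
      (D.tractionField ν i (φ i) (ψ i) (D.localTraction i 0 x)) = 0) : x = 0 := by
  -- Zero energy means zero velocity, so a pressure alone balances the tractions.
  have hc : ∀ i, ∃ c, ∀ r, D.localTraction i 0 x r = c := by
    intro i
    obtain ⟨X, hX, -⟩ := D.exists_pressure (hK i) (D.localTraction i 0 x)
    rw [D.eq_zero_of_aForm_eq_zero (hconn i) (hwall i) hν _ (h i)] at hX
    obtain ⟨c, -, hc⟩ := D.exists_const_of_balance (hconn i) (hcard i) (D.localTraction i 0 x) X
      fun v => by
        have := hX v
        rwa [map_zero, LinearMap.zero_apply, zero_add] at this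
    exact ⟨c, hc⟩
  choose c hc using hc
  have hU : ∀ i (α : Fin m), (D.face i (Sum.inl α)).Nonempty → x α = c i := fun i α hα => by
    rw [← hc i (Sum.inl ⟨α, hα⟩)]
    simp [localTraction, Ru_mulVec]
  -- The constant is zero at a pore with an inlet/outlet face and is passed back along the chain
  -- through shared interfaces.
  have hzero : ∀ i, c i = 0 := by
    intro i
    obtain ⟨j, hij, ⟨k⟩⟩ := hopen i
    induction hij using Relation.ReflTransGen.head_induction_on with
    | refl => rw [← hc j (Sum.inr k)]; simp [localTraction]
    | head hstep _ ih =>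
      obtain ⟨-, α, h1, h2⟩ := hstep
      rw [← hU _ α h1, hU _ α h2, ih]
  ext α
  -- Every interface touches some pore, so no component of `x` escapes.
  obtain ⟨i, j, -, hα⟩ := D.interface_two α
  rw [hU i α ((hα i).2 (Or.inl rfl)), hzero i]
  rfl

lemma schur_posDef (hν : 0 < ν) (hconn : ∀ i, (D.mesh i).EdgeConnected)
    (hcard : ∀ i, 3 ≤ (D.mesh i).triangles.card) (hwall : ∀ i, (D.wall i).Nonempty)
    (hopen : ∀ i, ∃ j, Relation.ReflTransGen D.Adjacent i j ∧ Nonempty (D.KFace j))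
    (hK : ∀ i, IsUnit (D.matK ν i (φ i) (ψ i))) : (D.schur ν φ ψ).PosDef := by
  rw [Matrix.posDef_iff_dotProduct_mulVec]
  refine ⟨?_, fun x hx => ?_⟩
  · rw [Matrix.IsHermitian, Matrix.conjTranspose_eq_transpose_of_trivial]
    exact D.schur_isSymm ν φ ψ hK
  · rw [star_trivial, dotProduct_schur_mulVec D ν φ ψ hK]
    have hnn : ∀ i, 0 ≤ D.aForm ν i
        (D.tractionField ν i (φ i) (ψ i) (D.localTraction i 0 x))
        (D.tractionField ν i (φ i) (ψ i) (D.localTraction i 0 x)) :=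
      fun i => formA_self_nonneg hν.le _
    refine lt_of_le_of_ne (Finset.sum_nonneg fun i _ => hnn i) fun h0 => hx ?_
    have h1 := (Finset.sum_eq_zero_iff_of_nonneg fun i _ => hnn i).1 h0.symm
    exact D.eq_zero_of_tractionField_eq_zero hν hconn hcard hwall hopen hK
      fun i => h1 i (Finset.mem_univ i)

end Global

/-! ### Global mass conservation -/

/-- If the total flux out of each pore vanishes and the fluxes at each interface are balanced, then
the net flux vanishes. -/
lemma netFlux_eq_zero (u : ∀ i, D.V i) (h : ∀ i, ∑ r, D.faceFlux i r (u i) = 0)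
    (hbal : ∑ i, (D.Ru i)ᵀ *ᵥ (fun r : D.UFace i => D.faceFlux i (Sum.inl r) (u i)) = 0) :
    D.netFlux (fun i => u i) = 0 := by
  have h1 : ∀ i, ∑ e ∈ D.exteriorEdges i, (D.mesh i).edgeFlux (u i) e =
      -∑ r : D.UFace i, D.faceFlux i (Sum.inl r) (u i) := fun i => by
    have h2 := D.sum_boundaryEdges_eq_exterior_add i fun e => (D.mesh i).edgeFlux (u i) e
    rw [sum_edgeFlux_eq, h] at h2
    exact eq_neg_of_add_eq_zero_left h2.symm
  -- Each row of `Ru` has exactly one entry 1, so summing the balance over all interfaces gives the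
  -- total internal flux.
  have h3 : ∀ i (y : D.UFace i → ℝ), ∑ α, ((D.Ru i)ᵀ *ᵥ y) α = ∑ r, y r := fun i y => by
    simp only [Matrix.mulVec, dotProduct, Matrix.transpose_apply]
    rw [Finset.sum_comm]
    simp [Ru]
  have h4 := congrArg (fun y : Fin m → ℝ => ∑ α, y α) hbal
  simp only [Finset.sum_apply, Pi.zero_apply, Finset.sum_const_zero] at h4
  rw [Finset.sum_comm, Finset.sum_congr rfl fun i _ => h3 i _] at h4
  rw [netFlux, Finset.sum_congr rfl fun i _ => h1 i, Finset.sum_neg_distrib, h4, neg_zero]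

end PoreDecomposition

end DDPNM

end

open DDPNM in
theorem theorem1 {N m mk : ℕ} (D : PoreDecomposition N m mk) (ν : ℝ) (hν : 0 < ν)
    (hconn : ∀ i, (D.mesh i).EdgeConnected)
    (hcard : ∀ i, 3 ≤ (D.mesh i).triangles.card)
    (hwall : ∀ i, (D.wall i).Nonempty)
    (hopen : ∀ i, ∃ j, Relation.ReflTransGen D.Adjacent i j ∧ Nonempty (D.KFace j))
    {ι κ : Fin N → Type*} [∀ i, Fintype (ι i)] [∀ i, DecidableEq (ι i)]
    [∀ i, Fintype (κ i)] [∀ i, DecidableEq (κ i)]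
    (φ : ∀ i, Module.Basis (ι i) ℝ (D.V i)) (ψ : ∀ i, Module.Basis (κ i) ℝ (D.Q i))
    (pk : Fin mk → ℝ) :
    (∀ i (t : D.LFace i → ℝ), ∃! UP : ι i ⊕ κ i → ℝ,
      D.matK ν i (φ i) (ψ i) *ᵥ UP = Sum.elim (∑ r, t r • D.load i (φ i) r) 0) ∧
    (D.schur ν φ ψ).IsSymm ∧ (D.schur ν φ ψ).PosDef ∧
    (∃! p : Fin m → ℝ, D.schur ν φ ψ *ᵥ p = D.forcing ν φ ψ pk) ∧
    ∀ p : Fin m → ℝ, D.schur ν φ ψ *ᵥ p = D.forcing ν φ ψ pk →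
      (∀ i, ∑ r, D.faceFlux i r (D.velocity ν i (φ i) (ψ i) pk p) = 0) ∧
      D.netFlux (fun i => D.velocity ν i (φ i) (ψ i) pk p) = 0 := by
  have hK : ∀ i, IsUnit (D.matK ν i (φ i) (ψ i)) := fun i => by
    rw [D.matK_eq]
    exact isUnit_saddleMatrix _ _ (D.eq_zero_of_aForm_eq_zero (hconn i) (hwall i) hν)
      (D.eq_zero_of_bForm_eq_zero (hconn i) (hcard i) (D.nonempty_LFace (hopen i)))
  have hpos := D.schur_posDef hν hconn hcard hwall hopen hK
  refine ⟨fun i t => ?_, D.schur_isSymm ν φ ψ hK, hpos, ?_, fun p hp => ?_⟩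
  · exact Function.Bijective.existsUnique ⟨Matrix.mulVec_injective_iff_isUnit.2 (hK i),
      Matrix.mulVec_surjective_iff_isUnit.2 (hK i)⟩ _
  · exact Function.Bijective.existsUnique ⟨Matrix.mulVec_injective_iff_isUnit.2 hpos.isUnit,
      Matrix.mulVec_surjective_iff_isUnit.2 hpos.isUnit⟩ _
  · have hflux : ∀ i, ∑ r, D.faceFlux i r (D.velocity ν i (φ i) (ψ i) pk p) = 0 := fun i => by
      rw [D.velocity_eq]
      obtain ⟨-, -, h⟩ := D.exists_pressure (hK i) (D.localTraction i pk p)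
      exact D.sum_faceFlux_eq_zero i h
    refine ⟨hflux, ?_⟩
    -- For a solution the residual is zero, which says that the fluxes at each interface balance.
    have hbal := D.forcing_sub_schur_mulVec ν φ ψ pk p
    rw [hp, sub_self] at hbal
    simp only [D.velocity_eq] at hflux hbal ⊢
    exact D.netFlux_eq_zero _ hflux hbal.symm
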